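/- Let $p$ be a prime, let $|\cdot|_p$ be the $p$-adic norm, let $d,m\ge 1$ and $n=d+m$, and let $\mu_{p,d}$ be the Haar measure on $\mathbb{Z}_p^d$ with $\mu_{p,d}(\mathbb{Z}_p^d)=1$. Balls in $\mathbb{Z}_p^d$ are open balls for the maximum of the $p$-adic norms of the coordinates. For $\boldsymbol{\alpha}=(\alpha_1,\dots,\alpha_m)\in\mathbb{Z}_p^m$ let $\tau(\boldsymbol\alpha)$ be the supremum of $\sum_{i=1}^m t_i$ over all $(t_1,\dots,t_m)\in\mathbb{R}_{>0}^m$ such that for infinitely many $Q\in\mathbb{N}$ there are integers $0<q_0\le Q$ and $|q_1|,\dots,|q_m|\le Q$ with $|q_0\alpha_i-q_i|_p<Q^{-t_i}$ for $1\le i\le m$. Fix $\boldsymbol\alpha$ with $\tau(\boldsymbol\alpha)=m+1$. Fix real numbers $\boldsymbol\tau_m=(\tau_{d+1},\dots,\tau_n)$ with each $\tau_{d+i}>1$ and $\sum_{i=1}^m\tau_{d+i}<m+1$, and put $$\mathcal{Q}(\boldsymbol\alpha,\boldsymbol\tau_m)=\Big\{q\in\mathbb{N},\ q\geq 1:\ \text{for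 each } 1\le i\le m \text{ there is } b\in\mathbb{Z},\ |b|\le q,\ \gcd(b,q)=1,\ \Big|\alpha_i-\frac{b}{q}\Big|_p<q^{-\tau_{d+i}}\Big\}.$$ For $q\in \mathcal{Q}(\boldsymbol\alpha,\boldsymbol\tau_m)$ let $R_q=\prod_{i=1}^d R_{q,i}\subset\mathbb{Z}_p^d$ with $R_{q,i}=\{a/q: a\in\mathbb{Z},\ |a|\le q,\ \gcd(a,q)=1\}$, let $\beta(q)=q$ and $\rho(t)=t^{-1}$, and for $M\in\mathbb{N}$ let $l_k=M^k$, $u_k=M^{k+1}$ and $J_k=\{q\in\mathcal{Q}(\boldsymbol\alpha,\boldsymbol\tau_m): M^k\le q<M^{k+1}\}$. For $s>0$ and $\boldsymbol{v}=(v_1,\dots,v_d)$ let $\Delta(R_q,s^{\boldsymbol v})=\prod_{i=1}^d\bigcup_{a\in R_{q,i}}B(a,s^{v_i})$. Let $$C_1=\max\Big\{3(6\sqrt m)^m,\ \frac{(m+2)!\,\pi^{m/2}\sqrt m^{\,m+1}}{\Gamma(\frac m2+1)}\Big\}.$$ Proposition. Let $v_1,\dots,v_d>1$ with $\sum_{i=1}^d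 v_i=n+1-\sum_{i=1}^m\tau_{d+i}$, and let $M>(3^dC_1)^{1/(n+1-\sum_{i=1}^m\tau_{d+i})}$ be an integer. Then there are constants $c>0$ and $r_0>0$ such that for every ball $B=B(x,r)$ with $x\in\mathbb{Z}_p^d$ and $0<r<r_0$, and for all sufficiently large $k$ (depending on $B$), $$\mu_{p,d}\Big(B\cap\bigcup_{q\in J_k}\Delta\big(R_q,\rho(u_k)^{\boldsymbol v}\big)\Big)\ \ge\ c\,\mu_{p,d}(B).$$ Consequently $(\{R_q\}_{q\in\mathcal{Q}(\boldsymbol\alpha,\boldsymbol\tau_m)},\beta)$ is a local ubiquitous system of rectangles with respect to $(\rho,\boldsymbol v)$: the index set $\mathcal{Q}(\boldsymbol\alpha,\boldsymbol\tau_m)$ is countably infinite, $0<l_k\le u_k$ with $l_k\to\infty$, $\rho$ is positive and non-increasing on $(0,\infty)$ with $\rho(\beta(q))\to0$ as $\beta(q)\to\infty$, and there is a constant $c>0$ such that for every ball $B\subset\mathbb{Z}_p^d$ (of any positive radius) $$\limsup_{k\to\infty}\ \mu_{p,d}\Big(B\cap\bigcup_{\substack{q\in\mathcal{Q}(\boldsymbol\alpha,\boldsymbol\tau_m)\\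 l_k\le q\le u_k}}\Delta\big(R_q,\rho(u_k)^{\boldsymbol v}\big)\Big)\ \ge\ c\,\mu_{p,d}(B).$$ -/

import Mathlib

open Filter Topology MeasureTheory
open scoped ENNReal

noncomputable section

namespace PadicUbiquity

/-! ### Local ubiquity for rectangles in a finite product of metric spaces -/

section Ubiquity

variable {ι κ : Type*} {X : κ → Type*} [∀ i, PseudoMetricSpace (X i)]

/-- The neighbourhood `Δ(A, b) = ⋃_{a ∈ A} B(a, b)` of a set, with open balls `B(a, b)`. -/
def nbhd {Y : Type*} [PseudoMetricSpace Y] (A : Set Y) (b : ℝ) : Set Y :=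
  ⋃ a ∈ A, Metric.ball a b

/-- For a resonant set `R = ∏ i, R i`, the set of hyperrectangles
`Δ(R, s ^ a) = ∏ i, Δ(R i, s ^ (a i))`. -/
def rectNbhd (R : ∀ i, Set (X i)) (s : ℝ) (a : κ → ℝ) : Set (∀ i, X i) :=
  Set.univ.pi fun i => nbhd (R i) (s ^ a i)

/-- `({R α}, β)` is a local ubiquitous system of rectangles with respect to `(ρ, a)`, for the
sequences `l`, `u`, the measures `m i` on the factors `X i`, and `J_k = {α : l k ≤ β α ≤ u k}`.
The fields before the last one are the standing conditions on the data. -/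
structure IsLocallyUbiquitous [Fintype κ] [∀ i, MeasurableSpace (X i)]
    (m : ∀ i, Measure (X i)) (R : ι → ∀ i, Set (X i)) (β : ι → ℝ)
    (ρ : ℝ → ℝ) (a : κ → ℝ) (l u : ℕ → ℝ) : Prop where
  countable : Countable ι
  infinite : Infinite ι
  beta_pos : ∀ α, 0 < β α
  exponent_pos : ∀ i, 0 < a i
  l_pos : ∀ k, 0 < l k
  l_le_u : ∀ k, l k ≤ u k
  l_tendsto : Tendsto l atTop atTop
  rho_pos : ∀ t, 0 < t → 0 < ρ t
  rho_antitone : AntitoneOn ρ (Set.Ioi 0)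
  rho_tendsto : Tendsto (fun α => ρ (β α)) (comap β atTop) (𝓝 0)
  ubiquity : ∃ c : ℝ, 0 < c ∧ ∀ (x : ∀ i, X i) (r : ℝ), 0 < r →
    ENNReal.ofReal c * Measure.pi m (Metric.ball x r) ≤
      limsup (fun k : ℕ => Measure.pi m
        (Metric.ball x r ∩ ⋃ α ∈ {α : ι | l k ≤ β α ∧ β α ≤ u k}, rectNbhd (R α) (ρ (u k)) a))
        atTop

end Ubiquity

/-! ### Haar measure on the `p`-adic integers -/

section Haar

variable (p : ℕ) [Fact p.Prime]

instance instMeasurableSpacePadicInt : MeasurableSpace ℤ_[p] := borel ℤ_[p]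

instance instBorelSpacePadicInt : BorelSpace ℤ_[p] := ⟨rfl⟩

/-- The Haar probability measure on `ℤ_p`. -/
def haar1 : Measure ℤ_[p] := Measure.addHaarMeasure ⊤

instance instIsAddHaarMeasureHaar1 : (haar1 p).IsAddHaarMeasure := by
  unfold haar1; infer_instance

instance instIsProbabilityMeasureHaar1 : IsProbabilityMeasure (haar1 p) :=
  ⟨by simpa [haar1] using Measure.addHaarMeasure_self (K₀ := (⊤ : TopologicalSpace.PositiveCompacts ℤ_[p]))⟩

/-- The Haar measure `μ_{p,d}` on `ℤ_p^d`, normalised by `μ_{p,d}(ℤ_p^d) = 1`. -/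
def haar (d : ℕ) : Measure (Fin d → ℤ_[p]) := Measure.pi fun _ => haar1 p

theorem haar_isAddHaarMeasure (d : ℕ) : (haar p d).IsAddHaarMeasure := by
  unfold haar; infer_instance

theorem haar_univ (d : ℕ) : haar p d Set.univ = 1 := by
  unfold haar; exact measure_univ

end Haar

/-! ### Diophantine data -/

section Diophantine

variable {p : ℕ} [Fact p.Prime]

/-- The Diophantine exponent `τ(x)` of `x ∈ ℤ_p^n`: the supremum of `∑ τ_i` over all weights
`τ ∈ ℝ_{>0}^n` such that, for infinitely many `Q`, there are integers `0 < q₀ ≤ Q` and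
`|q_i| ≤ Q` with `|q₀ x_i - q_i|_p < Q ^ (-τ_i)` for all `i`. -/
def diophantineExponent {n : ℕ} (x : Fin n → ℤ_[p]) : EReal :=
  sSup {s : EReal | ∃ τ : Fin n → ℝ, (∀ i, 0 < τ i) ∧
    (∃ᶠ Q : ℕ in atTop, ∃ (q₀ : ℕ) (q : Fin n → ℤ), 0 < q₀ ∧ q₀ ≤ Q ∧
      (∀ i, |q i| ≤ (Q : ℤ)) ∧
      ∀ i, ‖(q₀ : ℤ_[p]) * x i - (q i : ℤ_[p])‖ < (Q : ℝ) ^ (-τ i)) ∧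
    s = ((∑ i, τ i : ℝ) : EReal)}

/-- The denominators `𝒬(α, τ)`: positive integers `q` such that for every `i` there is a reduced
fraction `b / q` with `|b| ≤ q` and `|α_i - b / q|_p < q ^ (-τ_i)`. -/
def denominators {m : ℕ} (α : Fin m → ℤ_[p]) (τ : Fin m → ℝ) : Set ℕ :=
  {q : ℕ | 0 < q ∧ ∀ i, ∃ b : ℤ, |b| ≤ (q : ℤ) ∧ IsCoprime b (q : ℤ) ∧
    ‖(α i : ℚ_[p]) - (b : ℚ_[p]) / (q : ℚ_[p])‖ < (q : ℝ) ^ (-τ i)}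

variable (p) in
/-- The reduced fractions `b / q` with `|b| ≤ q` that lie in `ℤ_p`. -/
def reducedFractions (q : ℕ) : Set ℤ_[p] :=
  {x | ∃ b : ℤ, |b| ≤ (q : ℤ) ∧ IsCoprime b (q : ℤ) ∧
    (x : ℚ_[p]) = (b : ℚ_[p]) / (q : ℚ_[p])}

variable (p) in
/-- The resonant set `R_q = ∏_{i ≤ d} R_{q,i} ⊆ ℤ_p^d`, given by its factors. -/
def resonant (d : ℕ) (q : ℕ) : Fin d → Set ℤ_[p] := fun _ => reducedFractions p q

/-- The function `ρ(q) = q⁻¹`. -/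
def rho (t : ℝ) : ℝ := t⁻¹

/-- `C₁ = max {3 (6 √m)^m, (m+2)! π^{m/2} √m^{m+1} / Γ(m/2 + 1)}`: the constant in the upper bound
for the number of rational points of height at most `N` near a point of `ℤ_p^m`. -/
def C₁ (m : ℕ) : ℝ :=
  max (3 * (6 * √(m : ℝ)) ^ m)
    (((m + 2).factorial : ℝ) * Real.pi ^ ((m : ℝ) / 2) * √(m : ℝ) ^ (m + 1) /
      Real.Gamma ((m : ℝ) / 2 + 1))

/-- `J_k = {q ∈ 𝒬(α, τ) : M ^ k ≤ q < M ^ (k + 1)}`. -/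
def levelSet {m : ℕ} (α : Fin m → ℤ_[p]) (τ : Fin m → ℝ) (M k : ℕ) : Set ℕ :=
  {q | q ∈ denominators α τ ∧ M ^ k ≤ q ∧ q < M ^ (k + 1)}

end Diophantine

end PadicUbiquity

end

/-!
Write `N = M ^ (k + 1)` and `n = d + m`. For each ball `B` of `ℤ_p ^ d` and all large `N`, half of
the points `x ∈ B` admit an integer `q ∈ [N / 2, N)` prime to `p` together with reduced fractions
`a_j / q` and `b_i / q`, of numerators bounded by `q`, which are close to the `x_j` and to the `α_i`
(`exists_eventually_half_le`). The precision reached for `x` is weaker than `N ^ (-v_j)` by a factor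
`p ^ κ` independent of `B` and `N`. Shrinking the resulting neighbourhoods by this factor divides
the measure of their union by at most `p ^ (κ d)` (`haar_real_le_of_coarse`), and this is the
constant in the lower bound.

To find `q`, consider the lattice of the integer vectors `(q, a, b)` with `P ∣ q`, with `q x_j ≡ a_j`
and with `q α_i ≡ b_i` modulo powers of `p` given by the precisions; here `P` is divisible by `p` and
by all small primes. Since `∑ v_j + ∑ τ_i = n + 1`, its index is comparable to `N ^ (n + 1)`, and `κ`
makes it a small multiple of that. A lattice without short vectors has a small covering radius
(`covers_of_forall_le_abs`), so, outside the set of the `x` whose lattice has a vector much shorter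
than `N`, the coset of the `(q, a, b)` with `q ≡ 1` modulo `P` has a point near
`(3 N / 4, 0, …, 0)`. Its fractions are reduced unless some prime not dividing `P` divides `q` and
one of the `a_j` or `b_i`. The point `x` is therefore good unless it lies in one of three exceptional
sets (`isApproximable_of_notMem`): a short vector, a common prime of `q` and some `b_i`, or a common
prime of `q` and some `a_j`.

Each exceptional set is a union of boxes indexed by points `(q, b)` of the lattice of approximations
to `α` alone, or of one of its cosets, and a first-moment computation bounds its measure by a small
part of that of `B` (`half_le_real_isApproximable`). The points `(q, b)` are counted with the
covering radius of this smaller lattice, which is at most `N ^ γ` with `γ < 1`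
(`exists_eventually_covers`): a shorter vector than the index predicts would contradict that the
Diophantine exponent of `α` is at most `m + 1`. For the same reason the `p`-part of `q` is at most
`N ^ (1 - δ)` (`exists_eventually_pPart_le`), which keeps the boxes of the first exceptional set
evenly spread over `B`. The points `(q, b)` with a prime common to `q` and some `b_i` are counted
by translation along short lattice vectors when the prime is small, and by Ekedahl's argument with
`2 × 2` minors when it is large (`Covers.card_common_prime_le`).
-/

namespace PadicUbiquity

/-! ### Covering radius of a lattice -/

section Lattice

variable {ι : Type*}

/-- Every integer vector lies within sup-norm distance `ρ` of the subgroup `L`. -/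
def Covers (L : AddSubgroup (ι → ℤ)) (ρ : ℕ) : Prop :=
  ∀ z : ι → ℤ, ∃ w ∈ L, ∀ i, |z i - w i| ≤ ρ

/-- The coordinatewise truncation of an integer vector to the box `[-t, t]`. -/
def clamp (t : ℤ) (z : ι → ℤ) : ι → ℤ := fun i => max (-t) (min t (z i))

theorem exists_forall_abs_le [Fintype ι] (z : ι → ℤ) : ∃ n : ℕ, ∀ i, |z i| ≤ n := by
  refine ⟨∑ i, (z i).natAbs, fun i => ?_⟩
  rw [Int.abs_eq_natAbs]
  exact_mod_cast Finset.single_le_sum (f := fun i => (z i).natAbs) (fun _ _ => Nat.zero_le _)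
    (Finset.mem_univ i)

/-- If the nonzero vectors of `L` have sup norm at least `h`, then `L` has covering radius at most
`index / h ^ (card ι - 1)`. Indeed, let `z₀` be at distance `n₀` from `L` and have norm `n₀`. The
cubes of side `h` with lowest corners at the truncations of `z₀` to the boxes `[-k h, k h]`, for
`k ≤ n₀ / h`, are disjoint modulo `L`. -/
theorem covers_of_forall_le_abs [Fintype ι] (L : AddSubgroup (ι → ℤ)) (hL : L.index ≠ 0)
    {h ρ : ℕ} (hh : 0 < h) (hmin : ∀ z ∈ L, z ≠ 0 → ∃ i, (h : ℤ) ≤ |z i|)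
    (hρ : L.index * h ≤ ρ * h ^ Fintype.card ι) : Covers L ρ := by
  classical
  intro z
  by_contra! hcon
  have hex : ∃ n : ℕ, ∃ w ∈ L, ∀ i, |z i - w i| ≤ n := by
    obtain ⟨n, hn⟩ := exists_forall_abs_le z
    exact ⟨n, 0, L.zero_mem, by simpa using hn⟩
  obtain ⟨w₀, hw₀, hle⟩ := Nat.find_spec hex
  have hlt := fun n => Nat.find_min (m := n) hex
  set n₀ := Nat.find hex
  have hρn : ρ < n₀ := by
    by_contra! hn
    obtain ⟨i, hi⟩ := hcon w₀ hw₀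
    have := hle i
    omega
  set z₀ := z - w₀ with hz₀
  have hz₀le : ∀ i, |z₀ i| ≤ n₀ := hle
  have hfar : ∀ w ∈ L, ¬ ∀ i, |z₀ i - w i| ≤ (n₀ : ℤ) - 1 := by
    intro w hw hw'
    refine hlt (n₀ - 1) (by omega) ⟨w₀ + w, L.add_mem hw₀ hw, fun i => ?_⟩
    have := hw' i
    simp only [hz₀, Pi.sub_apply, Pi.add_apply] at this ⊢
    rw [← sub_sub]
    push_cast [show 1 ≤ n₀ by omega]
    exact this
  let f : Fin (n₀ / h + 1) × (ι → Fin h) → (ι → ℤ) ⧸ L := fun a =>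
    ((clamp ((a.1 : ℕ) * h : ℤ) z₀ + fun i => ((a.2 i : ℕ) : ℤ) : ι → ℤ) : (ι → ℤ) ⧸ L)
  -- Two points of one cube differ by less than `h`; points of different cubes cannot be congruent,
  -- since that would bring `z₀` closer to `L` than `n₀`.
  have key : ∀ (k k' : Fin (n₀ / h + 1)) (u u' : ι → Fin h), k < k' → f (k, u) ≠ f (k', u') := by
    intro k k' u u' hk he
    rw [QuotientAddGroup.eq] at he
    refine hfar _ he fun i => ?_
    have h1 := hz₀le i
    have h2 : (k' : ℕ) * h ≤ n₀ := by
      have := k'.2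
      calc (k' : ℕ) * h ≤ (n₀ / h) * h := Nat.mul_le_mul_right _ (by omega)
        _ ≤ n₀ := Nat.div_mul_le_self _ _
    have h3 : (k : ℕ) * h + h ≤ (k' : ℕ) * h := by
      have : (k : ℕ) + 1 ≤ k' := hk
      calc (k : ℕ) * h + h = (k + 1) * h := by ring
        _ ≤ _ := Nat.mul_le_mul_right _ this
    have h4 := (u i).2
    have h5 := (u' i).2
    simp only [clamp, Pi.add_apply, Pi.neg_apply]
    have h0 : 0 ≤ (k : ℕ) * h := Nat.zero_le _
    zify at h0 h2 h3
    generalize ((k : ℕ) : ℤ) * (h : ℤ) = A at *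
    generalize ((k' : ℕ) : ℤ) * (h : ℤ) = B at *
    rw [abs_le] at h1 ⊢
    simp only [max_def, min_def]
    split_ifs <;> omega
  have hinj : Function.Injective f := by
    rintro ⟨k, u⟩ ⟨k', u'⟩ he
    rcases lt_trichotomy k k' with hk | rfl | hk
    · exact absurd he (key _ _ _ _ hk)
    · by_contra hne
      have hu : u ≠ u' := fun h => hne (by rw [h])
      rw [QuotientAddGroup.eq] at he
      have hne0 : (-(clamp ((k : ℕ) * h : ℤ) z₀ + fun i => ((u i : ℕ) : ℤ)) +
          (clamp ((k : ℕ) * h : ℤ) z₀ + fun i => ((u' i : ℕ) : ℤ)) : ι → ℤ) ≠ 0 := by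
        intro h0
        refine hu (funext fun i => ?_)
        have := congrFun h0 i
        simp only [Pi.add_apply, Pi.neg_apply, Pi.zero_apply] at this
        exact Fin.ext (by omega)
      obtain ⟨i, hi⟩ := hmin _ he hne0
      have h4 := (u i).2
      have h5 := (u' i).2
      simp only [Pi.add_apply, Pi.neg_apply] at hi
      rw [le_abs] at hi
      omega
    · exact absurd he.symm (key _ _ _ _ hk)
  have : L.FiniteIndex := ⟨hL⟩
  have : Finite ((ι → ℤ) ⧸ L) := AddSubgroup.finite_quotient_of_finiteIndex
  have hcard := Nat.card_le_card_of_injective f hinj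
  rw [Nat.card_prod, Nat.card_fun, Nat.card_fin, Nat.card_fin, Nat.card_eq_fintype_card] at hcard
  change _ ≤ L.index at hcard
  have h6 : n₀ < (n₀ / h + 1) * h := by
    have := Nat.div_add_mod n₀ h
    have := Nat.mod_lt n₀ hh
    nlinarith
  have : n₀ * h ^ Fintype.card ι < n₀ * h ^ Fintype.card ι := by
    calc n₀ * h ^ Fintype.card ι < ((n₀ / h + 1) * h) * h ^ Fintype.card ι :=
          Nat.mul_lt_mul_of_pos_right h6 (by positivity)
      _ = ((n₀ / h + 1) * h ^ Fintype.card ι) * h := by ring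
      _ ≤ L.index * h := Nat.mul_le_mul_right _ hcard
      _ ≤ ρ * h ^ Fintype.card ι := hρ
      _ ≤ n₀ * h ^ Fintype.card ι := Nat.mul_le_mul_right _ hρn.le
  exact lt_irrefl _ this

/-- The integer points of the coset `u + L` in the box `[-R, R]`. -/
noncomputable def boxPoints [Fintype ι] (L : AddSubgroup (ι → ℤ)) (u : ι → ℤ) (R : ℕ) :
    Finset (ι → ℤ) := by
  classical
  exact (Fintype.piFinset fun _ => Finset.Icc (-(R : ℤ)) R).filter fun z => z - u ∈ L

theorem mem_boxPoints [Fintype ι] {L : AddSubgroup (ι → ℤ)} {u : ι → ℤ} {R : ℕ} {z : ι → ℤ} :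
    z ∈ boxPoints L u R ↔ (∀ i, |z i| ≤ R) ∧ z - u ∈ L := by
  classical
  simp [boxPoints, Fintype.mem_piFinset, abs_le]

theorem add_mem_boxPoints [Fintype ι] {L : AddSubgroup (ι → ℤ)} {u z w : ι → ℤ} {R S : ℕ}
    (hz : z ∈ boxPoints L u R) (hw : w ∈ L) (hwS : ∀ i, |z i + w i| ≤ S) :
    z + w ∈ boxPoints L u S := by
  rw [mem_boxPoints] at hz ⊢
  refine ⟨hwS, ?_⟩
  rw [add_sub_right_comm]
  exact L.add_mem hz.2 hw

/-- Translates of the points of a box by small representatives of `ℤ ^ ι / L` are distinct points of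
a slightly larger box. -/
theorem Covers.card_boxPoints_mul_index_le [Fintype ι] {L : AddSubgroup (ι → ℤ)} {ρ : ℕ}
    (hL : L.index ≠ 0) (hc : Covers L ρ) (u : ι → ℤ) (R : ℕ) :
    (boxPoints L u R).card * L.index ≤ (2 * (R + ρ) + 1) ^ Fintype.card ι := by
  classical
  have : L.FiniteIndex := ⟨hL⟩
  have : Finite ((ι → ℤ) ⧸ L) := AddSubgroup.finite_quotient_of_finiteIndex
  have := Fintype.ofFinite ((ι → ℤ) ⧸ L)
  have hrep : ∀ g : (ι → ℤ) ⧸ L, ∃ v : ι → ℤ, (v : (ι → ℤ) ⧸ L) = g ∧ ∀ i, |v i| ≤ ρ := by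
    intro g
    obtain ⟨v, rfl⟩ := QuotientAddGroup.mk_surjective g
    obtain ⟨w, hw, hle⟩ := hc v
    refine ⟨v - w, ?_, hle⟩
    rw [QuotientAddGroup.eq]
    simpa using hw
  choose rep hrep1 hrep2 using hrep
  have := Finset.card_le_card_of_injOn (s := boxPoints L u R ×ˢ (Finset.univ : Finset ((ι → ℤ) ⧸ L)))
    (t := Fintype.piFinset fun _ : ι => Finset.Icc (-((R + ρ : ℕ) : ℤ)) ((R + ρ : ℕ) : ℤ))
    (fun a => a.1 + rep a.2) ?_ ?_
  · rw [Finset.card_product, Finset.card_univ, ← Nat.card_eq_fintype_card,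
      Fintype.card_piFinset] at this
    refine this.trans (le_of_eq ?_)
    rw [Finset.prod_const, Int.card_Icc, Finset.card_univ]
    congr 1
    omega
  · rintro ⟨z, g⟩ hz
    simp only [Finset.coe_product, Set.mem_prod, Finset.mem_coe, mem_boxPoints] at hz
    simp only [Finset.mem_coe, Fintype.mem_piFinset, Finset.mem_Icc, Pi.add_apply]
    intro i
    have h1 := abs_le.1 (hz.1.1 i)
    have h2 := abs_le.1 (hrep2 g i)
    push_cast
    constructor <;> linarith [h1.1, h1.2, h2.1, h2.2]
  · rintro ⟨z, g⟩ hz ⟨z', g'⟩ hz' he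
    simp only [Finset.coe_product, Set.mem_prod, Finset.mem_coe, mem_boxPoints] at hz hz'
    have he' : z + rep g = z' + rep g' := he
    have hgg : g = g' := by
      rw [← hrep1 g, ← hrep1 g', QuotientAddGroup.eq]
      have : -rep g + rep g' = (z - u) - (z' - u) := by
        rw [eq_sub_of_add_eq he']; abel
      rw [this]
      exact L.sub_mem hz.1.2 hz'.1.2
    subst hgg
    rw [add_right_cancel he']

/-- A subgroup with covering radius `ρ` is generated by its vectors of norm at most `2ρ + 1`. -/
theorem Covers.le_closure [Fintype ι] {L : AddSubgroup (ι → ℤ)} {ρ : ℕ} (hc : Covers L ρ) :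
    L ≤ AddSubgroup.closure {w | w ∈ L ∧ ∀ i, |w i| ≤ (2 * ρ + 1 : ℕ)} := by
  have main : ∀ n : ℕ, ∀ z ∈ L, (∀ i, |z i| ≤ n) →
      z ∈ AddSubgroup.closure {w | w ∈ L ∧ ∀ i, |w i| ≤ (2 * ρ + 1 : ℕ)} := by
    intro n
    induction n with
    | zero =>
      intro z hz hle
      refine AddSubgroup.subset_closure ⟨hz, fun i => (hle i).trans ?_⟩
      push_cast; omega
    | succ n ih =>
      intro z hz hle
      by_cases hn : n + 1 ≤ 2 * ρ + 1
      · exact AddSubgroup.subset_closure ⟨hz, fun i => (hle i).trans (by exact_mod_cast hn)⟩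
      obtain ⟨w, hw, hwle⟩ := hc (clamp ((n : ℤ) - ρ) z)
      have h1 : ∀ i, |w i| ≤ n := by
        intro i
        have h1 := hwle i
        simp only [clamp] at h1
        rw [abs_le] at h1 ⊢
        omega
      have h2 : ∀ i, |(z - w) i| ≤ (2 * ρ + 1 : ℕ) := by
        intro i
        have h1 := hwle i
        have h2 := hle i
        simp only [clamp] at h1
        simp only [Pi.sub_apply]
        rw [abs_le] at h1 h2 ⊢
        omega
      have := AddSubgroup.add_mem _ (ih w hw h1)
        (AddSubgroup.subset_closure (k := {w | w ∈ L ∧ ∀ i, |w i| ≤ (2 * ρ + 1 : ℕ)})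
          ⟨L.sub_mem hz hw, h2⟩)
      simpa using this
  intro z hz
  obtain ⟨n, hn⟩ := exists_forall_abs_le z
  exact main n z hz hn

theorem Covers.exists_not_dvd [Fintype ι] {L : AddSubgroup (ι → ℤ)} {ρ : ℕ} (hc : Covers L ρ)
    {l : ℕ} (hli : ¬ l ∣ L.index) (i₀ : ι) :
    ∃ w ∈ L, (∀ i, |w i| ≤ (2 * ρ + 1 : ℕ)) ∧ ¬ (l : ℤ) ∣ w i₀ := by
  classical
  by_contra! hcon
  have hall : ∀ w ∈ L, (l : ℤ) ∣ w i₀ := by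
    intro w hw
    have hcl := hc.le_closure hw
    clear hw
    induction hcl using AddSubgroup.closure_induction with
    | mem x hx => exact hcon x hx.1 hx.2
    | zero => simp
    | add x y _ _ hx hy => exact dvd_add hx hy
    | neg x _ hx => exact hx.neg_right
  have := hall _ (L.nsmul_index_mem (Pi.single i₀ 1))
  simp only [Pi.smul_apply, Pi.single_eq_same, nsmul_eq_mul, mul_one] at this
  exact hli (by exact_mod_cast this)

/-- The `2 × 2` minor of two integer vectors in the coordinates `i₀`, `i₁`. -/
def minor (i₀ i₁ : ι) (w w' : ι → ℤ) : ℤ := w i₀ * w' i₁ - w i₁ * w' i₀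

theorem minor_swap (i₀ i₁ : ι) (w w' : ι → ℤ) : minor i₀ i₁ w w' = -minor i₀ i₁ w' w := by
  unfold minor; ring

theorem minor_add (i₀ i₁ : ι) (w x y : ι → ℤ) :
    minor i₀ i₁ w (x + y) = minor i₀ i₁ w x + minor i₀ i₁ w y := by
  simp only [minor, Pi.add_apply]; ring

theorem minor_neg (i₀ i₁ : ι) (w x : ι → ℤ) : minor i₀ i₁ w (-x) = -minor i₀ i₁ w x := by
  simp only [minor, Pi.neg_apply]; ring

/-- Modulo a prime outside the index of `L`, the short vectors of `L` span the plane of any two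
coordinates. -/
theorem Covers.exists_not_dvd_minor [Fintype ι] {L : AddSubgroup (ι → ℤ)} {ρ : ℕ}
    (hc : Covers L ρ) {l : ℕ} (hl : l.Prime) (hli : ¬ l ∣ L.index) {i₀ i₁ : ι} (hi : i₀ ≠ i₁) :
    ∃ w ∈ L, ∃ w' ∈ L, (∀ i, |w i| ≤ (2 * ρ + 1 : ℕ)) ∧ (∀ i, |w' i| ≤ (2 * ρ + 1 : ℕ)) ∧
      ¬ (l : ℤ) ∣ minor i₀ i₁ w w' := by
  classical
  by_contra! hcon
  have h1 : ∀ w ∈ L, (∀ i, |w i| ≤ (2 * ρ + 1 : ℕ)) → ∀ w' ∈ L, (l : ℤ) ∣ minor i₀ i₁ w w' := by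
    intro w hw hwle w' hw'
    have hcl := hc.le_closure hw'
    clear hw'
    induction hcl using AddSubgroup.closure_induction with
    | mem x hx => exact hcon w hw x hx.1 hwle hx.2
    | zero => simp [minor]
    | add x y _ _ hx hy =>
      rw [minor_add]; exact dvd_add hx hy
    | neg x _ hx =>
      rw [minor_neg]; exact hx.neg_right
  have h2 : ∀ w ∈ L, ∀ w' ∈ L, (l : ℤ) ∣ minor i₀ i₁ w w' := by
    intro w hw w' hw'
    have hcl := hc.le_closure hw'
    clear hw'
    induction hcl using AddSubgroup.closure_induction with
    | mem x hx =>
      rw [minor_swap]; exact (h1 x hx.1 hx.2 w hw).neg_right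
    | zero => simp [minor]
    | add x y _ _ hx hy =>
      rw [minor_add]; exact dvd_add hx hy
    | neg x _ hx =>
      rw [minor_neg]; exact hx.neg_right
  have h3 := h2 _ (L.nsmul_index_mem (Pi.single i₀ 1)) _ (L.nsmul_index_mem (Pi.single i₁ 1))
  simp only [minor, Pi.smul_apply, Pi.single_eq_same, nsmul_eq_mul, mul_one, ne_eq, hi, hi.symm,
    not_false_eq_true, Pi.single_eq_of_ne, mul_zero, sub_zero] at h3
  have h4 : l ∣ L.index * L.index := by exact_mod_cast h3
  rcases hl.dvd_mul.1 h4 with h | h <;> exact hli h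

end Lattice

/-! ### Counting lattice points with a common prime factor -/

section Sieve

theorem card_primeFactors_le_of_lt_two_pow {n K : ℕ} (hn : n < 2 ^ K) :
    n.primeFactors.card ≤ K := by
  rcases Nat.eq_zero_or_pos n with rfl | h0
  · simp
  have h1 : 2 ^ n.primeFactors.card ≤ ∏ q ∈ n.primeFactors, q :=
    Finset.pow_card_le_prod _ _ _ fun q hq => (Nat.prime_of_mem_primeFactors hq).two_le
  have h2 := Nat.le_of_dvd h0 (Nat.prod_primeFactors_dvd n)
  exact ((Nat.pow_lt_pow_iff_right (by norm_num : 1 < 2)).1 ((h1.trans h2).trans_lt hn)).le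

theorem eq_of_dvd_sub_mul {l a b : ℕ} (hl : l.Prime) {c : ℤ} (hc : ¬ (l : ℤ) ∣ c) (ha : a < l)
    (hb : b < l) (h : (l : ℤ) ∣ ((a : ℤ) - b) * c) : a = b := by
  have hd : (l : ℤ) ∣ (a : ℤ) - b :=
    ((Nat.prime_iff_prime_int.1 hl).dvd_mul.1 h).resolve_right hc
  have := Int.eq_zero_of_abs_lt_dvd hd (by rw [abs_lt]; omega)
  omega

variable {ι : Type*} [Fintype ι] {L : AddSubgroup (ι → ℤ)} {ρ : ℕ}

theorem abs_add_mul_le {z w : ℤ} {j X R S : ℕ} (hz : |z| ≤ R) (hw : |w| ≤ S) (hj : j ≤ X)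
    (h : X * S ≤ R) : |z + j * w| ≤ (2 * R : ℕ) := by
  have h1 : (j : ℤ) * |w| ≤ X * S := by gcongr
  have h2 : (X : ℤ) * S ≤ R := by exact_mod_cast h
  calc |z + j * w| ≤ |z| + |(j : ℤ) * w| := abs_add_le _ _
    _ = |z| + j * |w| := by rw [abs_mul, Nat.abs_cast]
    _ ≤ _ := by push_cast; linarith

open Classical in
/-- The translates `z + j w`, for `j < X ≤ l`, by a short vector `w` with `w i₀` prime to `l` are
distinct. -/
theorem Covers.mul_card_dvd_le (hc : Covers L ρ) {l X R : ℕ} (hl : l.Prime)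
    (hli : ¬ l ∣ L.index) (i₀ : ι) (u : ι → ℤ) (hX : X ≤ l) (hR : X * (2 * ρ + 1) ≤ R) :
    X * ((boxPoints L u R).filter fun z => (l : ℤ) ∣ z i₀).card ≤ (boxPoints L u (2 * R)).card := by
  obtain ⟨w, hw, hwle, hdvd⟩ := hc.exists_not_dvd hli i₀
  rw [← Finset.card_range X, ← Finset.card_product]
  refine Finset.card_le_card_of_injOn (fun a => a.2 + (a.1 : ℕ) • w) ?_ ?_
  · rintro ⟨j, z⟩ h
    simp only [Finset.coe_product, Set.mem_prod, Finset.mem_coe, Finset.mem_filter,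
      Finset.mem_range] at h
    refine add_mem_boxPoints h.2.1 (L.nsmul_mem hw _) fun i => ?_
    simpa using abs_add_mul_le ((mem_boxPoints.1 h.2.1).1 i) (hwle i) h.1.le hR
  · rintro ⟨j, z⟩ h ⟨j', z'⟩ h' he
    simp only [Finset.coe_product, Set.mem_prod, Finset.mem_coe, Finset.mem_filter,
      Finset.mem_range] at h h'
    have he' : z + j • w = z' + j' • w := he
    have h0 := congrFun he' i₀
    simp only [Pi.add_apply, Pi.smul_apply] at h0; simp only [nsmul_eq_mul] at h0
    have hjj : j = j' := by
      refine eq_of_dvd_sub_mul hl hdvd (by omega) (by omega) ?_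
      have : ((j : ℤ) - j') * w i₀ = z' i₀ - z i₀ := by linarith
      rw [this]
      exact dvd_sub h'.2.2 h.2.2
    subst hjj
    rw [add_right_cancel he']

open Classical in
/-- The translates `z + j w + j' w'`, for `j, j' < l`, by short vectors whose minor is prime to `l` are
distinct. -/
theorem Covers.sq_mul_card_dvd_le (hc : Covers L ρ) {l R : ℕ} (hl : l.Prime)
    (hli : ¬ l ∣ L.index) {i₀ i₁ : ι} (hi : i₀ ≠ i₁) (u : ι → ℤ) (hR : 2 * l * (2 * ρ + 1) ≤ R) :
    l ^ 2 * ((boxPoints L u R).filter fun z => (l : ℤ) ∣ z i₀ ∧ (l : ℤ) ∣ z i₁).card ≤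
      (boxPoints L u (2 * R)).card := by
  obtain ⟨w, hw, w', hw', hwle, hwle', hdvd⟩ := hc.exists_not_dvd_minor hl hli hi
  rw [sq, mul_assoc]
  nth_rewrite 1 [← Finset.card_range l]
  nth_rewrite 2 [← Finset.card_range l]
  rw [← Finset.card_product, ← Finset.card_product]
  refine Finset.card_le_card_of_injOn (fun a => a.2.2 + ((a.1 : ℕ) • w + (a.2.1 : ℕ) • w')) ?_ ?_
  · rintro ⟨j, j', z⟩ h
    simp only [Finset.coe_product, Set.mem_prod, Finset.mem_coe, Finset.mem_filter,
      Finset.mem_range] at h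
    refine add_mem_boxPoints h.2.2.1
      (L.add_mem (L.nsmul_mem hw _) (L.nsmul_mem hw' _)) fun i => ?_
    have h1 := (mem_boxPoints.1 h.2.2.1).1 i
    simp only [Pi.add_apply, Pi.smul_apply]; simp only [nsmul_eq_mul]
    have h2 : (j : ℤ) * |w i| ≤ l * (2 * ρ + 1 : ℕ) := by
      have := h.1.le; have := hwle i; gcongr
    have h3 : (j' : ℤ) * |w' i| ≤ l * (2 * ρ + 1 : ℕ) := by
      have := h.2.1.le; have := hwle' i; gcongr
    have h4 : (2 : ℤ) * l * (2 * ρ + 1 : ℕ) ≤ R := by exact_mod_cast hR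
    calc |z i + (j * w i + j' * w' i)| ≤ |z i| + (|(j : ℤ) * w i| + |(j' : ℤ) * w' i|) :=
          (abs_add_le _ _).trans (by gcongr; exact abs_add_le _ _)
      _ = |z i| + (j * |w i| + j' * |w' i|) := by rw [abs_mul, abs_mul, Nat.abs_cast, Nat.abs_cast]
      _ ≤ _ := by push_cast at *; linarith
  · rintro ⟨j, k, z⟩ h ⟨j', k', z'⟩ h' he
    simp only [Finset.coe_product, Set.mem_prod, Finset.mem_coe, Finset.mem_filter,
      Finset.mem_range] at h h'
    have he' : z + (j • w + k • w') = z' + (j' • w + k' • w') := he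
    have h0 := congrFun he' i₀
    have h1 := congrFun he' i₁
    simp only [Pi.add_apply, Pi.smul_apply] at h0 h1; simp only [nsmul_eq_mul] at h0 h1
    have d0 : (l : ℤ) ∣ z' i₀ - z i₀ := dvd_sub h'.2.2.2.1 h.2.2.2.1
    have d1 : (l : ℤ) ∣ z' i₁ - z i₁ := dvd_sub h'.2.2.2.2 h.2.2.2.2
    have hjj : j = j' := by
      refine eq_of_dvd_sub_mul hl hdvd (by omega) (by omega) ?_
      have : ((j : ℤ) - j') * minor i₀ i₁ w w' =
          (z' i₀ - z i₀) * w' i₁ - (z' i₁ - z i₁) * w' i₀ := by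
        unfold minor
        linear_combination (w' i₁) * h0 - (w' i₀) * h1
      rw [this]
      exact dvd_sub (d0.mul_right _) (d1.mul_right _)
    have hkk : k = k' := by
      refine eq_of_dvd_sub_mul hl hdvd (by omega) (by omega) ?_
      have : ((k : ℤ) - k') * minor i₀ i₁ w w' =
          (z' i₁ - z i₁) * w i₀ - (z' i₀ - z i₀) * w i₁ := by
        unfold minor
        linear_combination (w i₀) * h1 - (w i₁) * h0
      rw [this]
      exact dvd_sub (d1.mul_right _) (d0.mul_right _)
    subst hjj hkk
    rw [add_right_cancel he']

theorem card_boxPoints_mono {L : AddSubgroup (ι → ℤ)} (u : ι → ℤ) {R S : ℕ} (h : R ≤ S) :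
    (boxPoints L u R).card ≤ (boxPoints L u S).card := by
  refine Finset.card_le_card fun z hz => ?_
  rw [mem_boxPoints] at hz ⊢
  exact ⟨fun i => (hz.1 i).trans (by exact_mod_cast h), hz.2⟩

theorem exists_prime_not_dvd {n : ℕ} (hn : n ≠ 0) : ∃ l : ℕ, l.Prime ∧ ¬ l ∣ n := by
  obtain ⟨l, hl, hp⟩ := Nat.exists_infinite_primes (n + 1)
  exact ⟨l, hp, fun h => by have := Nat.le_of_dvd (Nat.pos_of_ne_zero hn) h; omega⟩

open Classical in
/-- The large-prime part of the sieve, in the manner of Ekedahl. Along a line `z + j w` the minor of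
`z + j w` and `w` does not depend on `j`, it is divisible by every common prime factor of the two
coordinates, and it has few prime factors. -/
theorem Covers.mul_card_large_prime_le (hc : Covers L ρ) (hL : L.index ≠ 0) {X R K : ℕ}
    (hX : 1 ≤ X) {i₀ i₁ : ι} (hi : i₀ ≠ i₁) (u : ι → ℤ) (hR : X * (2 * ρ + 1) ≤ R)
    (hK : 4 * R ^ 2 < 2 ^ K) :
    X * ((boxPoints L u R).filter fun z =>
      ∃ l : ℕ, l.Prime ∧ X ≤ l ∧ ¬ l ∣ L.index ∧ (l : ℤ) ∣ z i₀ ∧ (l : ℤ) ∣ z i₁).card ≤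
      (boxPoints L u (2 * R)).card * (1 + 2 * K) := by
  obtain ⟨l₀, hl₀, hl₀i⟩ := exists_prime_not_dvd hL
  obtain ⟨w, hw, w', hw', hwle, hwle', hdvd⟩ := hc.exists_not_dvd_minor hl₀ hl₀i hi
  have hmin : minor i₀ i₁ w w' ≠ 0 := fun h => hdvd (h ▸ dvd_zero _)
  have hρR : 2 * ρ + 1 ≤ R := le_trans (Nat.le_mul_of_pos_left _ hX) hR
  have hadd : ∀ (z v : ι → ℤ) (j : ℕ) (x : ι → ℤ),
      minor i₀ i₁ (z + j • v) x = minor i₀ i₁ z x + j * minor i₀ i₁ v x := by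
    intro z v j x
    simp only [minor, Pi.add_apply, Pi.smul_apply]; simp only [nsmul_eq_mul]; ring
  have hself : minor i₀ i₁ w w = 0 := by simp only [minor]; ring
  set T := boxPoints L u (2 * R)
  -- The points with vanishing minor (`F₁`) are moved along `w'`. Those with a common prime that does
  -- not divide both coordinates of `w` (`F₂`) are moved along `w`, and the remaining ones have a
  -- prime in the short list `D`.
  set F₁ := (boxPoints L u R).filter fun z => minor i₀ i₁ z w = 0 with hF₁
  set F₂ := (boxPoints L u R).filter fun z => minor i₀ i₁ z w ≠ 0 ∧
    ∃ l : ℕ, l.Prime ∧ X ≤ l ∧ (l : ℤ) ∣ z i₀ ∧ (l : ℤ) ∣ z i₁ ∧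
      ¬ ((l : ℤ) ∣ w i₀ ∧ (l : ℤ) ∣ w i₁) with hF₂
  set D := ((w i₀).gcd (w i₁)).primeFactors.filter fun l => X ≤ l ∧ ¬ l ∣ L.index with hD
  have hstep : ∀ (v : ι → ℤ), v ∈ L → (∀ i, |v i| ≤ (2 * ρ + 1 : ℕ)) → ∀ z ∈ boxPoints L u R,
      ∀ j < X, z + j • v ∈ T := by
    intro v hv hvle z hz j hj
    refine add_mem_boxPoints hz (L.nsmul_mem hv _) fun i => ?_
    simpa using abs_add_mul_le ((mem_boxPoints.1 hz).1 i) (hvle i) hj.le hR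
  have h1 : X * F₁.card ≤ T.card := by
    rw [← Finset.card_range X, ← Finset.card_product]
    refine Finset.card_le_card_of_injOn (fun a => a.2 + (a.1 : ℕ) • w') ?_ ?_
    · rintro ⟨j, z⟩ h
      simp only [hF₁, Finset.coe_product, Set.mem_prod, Finset.mem_coe, Finset.mem_filter,
        Finset.mem_range] at h
      exact hstep w' hw' hwle' z h.2.1 j h.1
    · rintro ⟨j, z⟩ h ⟨j', z'⟩ h' he
      simp only [hF₁, Finset.coe_product, Set.mem_prod, Finset.mem_coe, Finset.mem_filter,
        Finset.mem_range] at h h'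
      have he' : z + j • w' = z' + j' • w' := he
      have h0 := congrArg (fun y => minor i₀ i₁ y w) he'
      simp only [hadd, h.2.2, h'.2.2, zero_add] at h0
      have hne : minor i₀ i₁ w' w ≠ 0 := by rw [minor_swap]; exact neg_ne_zero.2 hmin
      have hjj : j = j' := by exact_mod_cast mul_right_cancel₀ hne h0
      subst hjj
      rw [add_right_cancel he']
  have h2 : X * F₂.card ≤ T.card * K := by
    have hex : ∀ z : ι → ℤ, ∃ l : ℕ, z ∈ F₂ → l.Prime ∧ X ≤ l ∧ (l : ℤ) ∣ z i₀ ∧ (l : ℤ) ∣ z i₁ ∧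
        ¬ ((l : ℤ) ∣ w i₀ ∧ (l : ℤ) ∣ w i₁) := by
      intro z
      by_cases hz : z ∈ F₂
      · obtain ⟨l, hl⟩ := (Finset.mem_filter.1 hz).2.2
        exact ⟨l, fun _ => hl⟩
      · exact ⟨0, fun h => absurd h hz⟩
    choose q hq using hex
    have hmem : ∀ z ∈ F₂, z ∈ boxPoints L u R ∧ minor i₀ i₁ z w ≠ 0 := fun z hz =>
      ⟨(Finset.mem_filter.1 hz).1, (Finset.mem_filter.1 hz).2.1⟩
    have hsig : X * F₂.card ≤
        (T.sigma fun y => (minor i₀ i₁ y w).natAbs.primeFactors).card := by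
      rw [← Finset.card_range X, ← Finset.card_product]
      refine Finset.card_le_card_of_injOn (fun a => ⟨a.2 + (a.1 : ℕ) • w, q a.2⟩) ?_ ?_
      · rintro ⟨j, z⟩ h
        simp only [Finset.coe_product, Set.mem_prod, Finset.mem_coe, Finset.mem_range] at h
        obtain ⟨hp, hXl, d0, d1, -⟩ := hq z h.2
        obtain ⟨hzb, hne⟩ := hmem z h.2
        simp only [Finset.coe_sigma, Set.mem_sigma_iff, Finset.mem_coe, Nat.mem_primeFactors]
        rw [hadd, hself, mul_zero, add_zero]
        refine ⟨hstep w hw hwle z hzb j h.1, hp, ?_, by simpa using hne⟩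
        rw [← Int.natCast_dvd]
        exact dvd_sub (d0.mul_right _) (d1.mul_right _)
      · rintro ⟨j, z⟩ h ⟨j', z'⟩ h' he
        simp only [Finset.coe_product, Set.mem_prod, Finset.mem_coe, Finset.mem_range] at h h'
        simp only [Sigma.mk.injEq, heq_eq_eq] at he
        obtain ⟨he', hqq⟩ := he
        obtain ⟨hp, hXl, d0, d1, hnd⟩ := hq z h.2
        obtain ⟨-, -, d0', d1', -⟩ := hq z' h'.2
        rw [← hqq] at d0' d1'
        have e0 := congrFun he' i₀
        have e1 := congrFun he' i₁
        simp only [Pi.add_apply, Pi.smul_apply] at e0 e1; simp only [nsmul_eq_mul] at e0 e1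
        have hjj : j = j' := by
          by_cases hw0 : ((q z : ℕ) : ℤ) ∣ w i₀
          · refine eq_of_dvd_sub_mul hp (fun h => hnd ⟨hw0, h⟩) (h.1.trans_le hXl)
              (h'.1.trans_le hXl) ?_
            have : ((j : ℤ) - j') * w i₁ = z' i₁ - z i₁ := by linarith
            rw [this]
            exact dvd_sub d1' d1
          · refine eq_of_dvd_sub_mul hp hw0 (h.1.trans_le hXl) (h'.1.trans_le hXl) ?_
            have : ((j : ℤ) - j') * w i₀ = z' i₀ - z i₀ := by linarith
            rw [this]
            exact dvd_sub d0' d0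
        subst hjj
        rw [add_right_cancel he']
    refine hsig.trans ?_
    rw [Finset.card_sigma, ← smul_eq_mul]
    refine Finset.sum_le_card_nsmul _ _ _ fun y hy => card_primeFactors_le_of_lt_two_pow ?_
    refine lt_of_le_of_lt ?_ hK
    have hy := (mem_boxPoints.1 hy).1
    have b1 : |y i₀ * w i₁| ≤ (2 * R : ℕ) * R := by
      rw [abs_mul]
      exact mul_le_mul (hy _) ((hwle _).trans (by exact_mod_cast hρR)) (abs_nonneg _) (by positivity)
    have b2 : |y i₁ * w i₀| ≤ (2 * R : ℕ) * R := by
      rw [abs_mul]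
      exact mul_le_mul (hy _) ((hwle _).trans (by exact_mod_cast hρR)) (abs_nonneg _) (by positivity)
    zify
    calc |minor i₀ i₁ y w| ≤ |y i₀ * w i₁| + |y i₁ * w i₀| := abs_sub _ _
      _ ≤ _ := by push_cast at *; linarith
  have h3 : X * (D.biUnion fun l => (boxPoints L u R).filter fun z => (l : ℤ) ∣ z i₀).card ≤
      T.card * K := by
    have hDK : D.card ≤ K := by
      refine (Finset.card_filter_le _ _).trans (card_primeFactors_le_of_lt_two_pow ?_)
      have hg : (w i₀).gcd (w i₁) ≤ R := by
        by_cases h0 : w i₀ = 0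
        · have hne : w i₁ ≠ 0 := fun h1 => hmin (by simp [minor, h0, h1])
          have := Nat.le_of_dvd (Int.natAbs_pos.2 hne) (Int.gcd_dvd_natAbs_right (w i₀) (w i₁))
          have := hwle i₁
          rw [Int.abs_eq_natAbs] at this
          omega
        · have := Nat.le_of_dvd (Int.natAbs_pos.2 h0) (Int.gcd_dvd_natAbs_left (w i₀) (w i₁))
          have := hwle i₀
          rw [Int.abs_eq_natAbs] at this
          omega
      have : R ≤ R ^ 2 := Nat.le_self_pow (by norm_num) R
      omega
    calc X * (D.biUnion fun l => (boxPoints L u R).filter fun z => (l : ℤ) ∣ z i₀).card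
        ≤ X * ∑ l ∈ D, ((boxPoints L u R).filter fun z => (l : ℤ) ∣ z i₀).card :=
          Nat.mul_le_mul_left _ Finset.card_biUnion_le
      _ = ∑ l ∈ D, X * ((boxPoints L u R).filter fun z => (l : ℤ) ∣ z i₀).card := Finset.mul_sum _ _ _
      _ ≤ D.card • T.card := by
          refine Finset.sum_le_card_nsmul _ _ _ fun l hl => ?_
          simp only [hD, Finset.mem_filter, Nat.mem_primeFactors] at hl
          exact hc.mul_card_dvd_le hl.1.1 hl.2.2 i₀ u hl.2.1 hR
      _ ≤ T.card * K := by rw [smul_eq_mul, mul_comm]; exact Nat.mul_le_mul_left _ hDK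
  have hsub : ((boxPoints L u R).filter fun z =>
      ∃ l : ℕ, l.Prime ∧ X ≤ l ∧ ¬ l ∣ L.index ∧ (l : ℤ) ∣ z i₀ ∧ (l : ℤ) ∣ z i₁) ⊆
      F₁ ∪ F₂ ∪ D.biUnion fun l => (boxPoints L u R).filter fun z => (l : ℤ) ∣ z i₀ := by
    intro z hz
    obtain ⟨hz, l, hl, hXl, hli, d0, d1⟩ := Finset.mem_filter.1 hz
    rw [Finset.mem_union, Finset.mem_union]
    by_cases hm : minor i₀ i₁ z w = 0
    · exact Or.inl (Or.inl (Finset.mem_filter.2 ⟨hz, hm⟩))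
    by_cases hwd : (l : ℤ) ∣ w i₀ ∧ (l : ℤ) ∣ w i₁
    · refine Or.inr (Finset.mem_biUnion.2 ⟨l, ?_, Finset.mem_filter.2 ⟨hz, d0⟩⟩)
      simp only [hD, Finset.mem_filter, Nat.mem_primeFactors]
      refine ⟨⟨hl, Int.dvd_gcd hwd.1 hwd.2, fun h0 => ?_⟩, hXl, hli⟩
      rw [Int.gcd_eq_zero_iff] at h0
      exact hmin (by simp [minor, h0.1, h0.2])
    · exact Or.inl (Or.inr (Finset.mem_filter.2 ⟨hz, hm, l, hl, hXl, d0, d1, hwd⟩))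
  have hcard := (Finset.card_le_card hsub).trans
    ((Finset.card_union_le _ _).trans (Nat.add_le_add_right (Finset.card_union_le _ _) _))
  refine (Nat.mul_le_mul_left _ hcard).trans ?_
  rw [mul_add, mul_add]
  calc _ ≤ T.card + T.card * K + T.card * K := add_le_add (add_le_add h1 h2) h3
    _ = _ := by ring

open Classical in
/-- Few points of a coset of `L` in a box have two given coordinates with a common prime factor
outside the index of `L`, if that index is divisible by all small primes. -/
theorem Covers.card_common_prime_le (hc : Covers L ρ) (hL : L.index ≠ 0) {X R K y : ℕ}
    (hX : 1 ≤ X) {i₀ i₁ : ι} (hi : i₀ ≠ i₁) (u : ι → ℤ) (hR : 2 * X * (2 * ρ + 1) ≤ R)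
    (hK : 4 * R ^ 2 < 2 ^ K) (hy : ∀ l : ℕ, l.Prime → l ≤ y → l ∣ L.index) :
    (((boxPoints L u R).filter fun z =>
      ∃ l : ℕ, l.Prime ∧ ¬ l ∣ L.index ∧ (l : ℤ) ∣ z i₀ ∧ (l : ℤ) ∣ z i₁).card : ℝ) ≤
      (boxPoints L u (2 * R)).card * (2 / (y + 1) + (1 + 2 * K) / X) := by
  set T := boxPoints L u (2 * R)
  set A := (Finset.Ioo y X).filter fun l => l.Prime ∧ ¬ l ∣ L.index with hA
  set B := (boxPoints L u R).filter fun z =>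
      ∃ l : ℕ, l.Prime ∧ X ≤ l ∧ ¬ l ∣ L.index ∧ (l : ℤ) ∣ z i₀ ∧ (l : ℤ) ∣ z i₁ with hB
  have hsub : ((boxPoints L u R).filter fun z =>
      ∃ l : ℕ, l.Prime ∧ ¬ l ∣ L.index ∧ (l : ℤ) ∣ z i₀ ∧ (l : ℤ) ∣ z i₁) ⊆
      (A.biUnion fun l => (boxPoints L u R).filter fun z => (l : ℤ) ∣ z i₀ ∧ (l : ℤ) ∣ z i₁) ∪
        B := by
    intro z hz
    obtain ⟨hz, l, hl, hli, d0, d1⟩ := Finset.mem_filter.1 hz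
    rw [Finset.mem_union]
    by_cases hlX : X ≤ l
    · exact Or.inr (Finset.mem_filter.2 ⟨hz, l, hl, hlX, hli, d0, d1⟩)
    · refine Or.inl (Finset.mem_biUnion.2 ⟨l, ?_, Finset.mem_filter.2 ⟨hz, d0, d1⟩⟩)
      refine Finset.mem_filter.2 ⟨Finset.mem_Ioo.2 ⟨?_, by omega⟩, hl, hli⟩
      by_contra! h
      exact hli (hy l hl h)
  have hXpos : (0 : ℝ) < X := by exact_mod_cast hX
  have hBle : (B.card : ℝ) ≤ T.card * ((1 + 2 * K) / X) := by
    have : X * B.card ≤ T.card * (1 + 2 * K) := hc.mul_card_large_prime_le hL hX hi u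
      (le_trans (Nat.mul_le_mul_right _ (by omega)) hR) hK
    have : (X : ℝ) * B.card ≤ T.card * (1 + 2 * K) := by exact_mod_cast this
    rw [← mul_div_assoc, le_div_iff₀ hXpos]
    linarith
  have hAle : ((A.biUnion fun l => (boxPoints L u R).filter fun z =>
      (l : ℤ) ∣ z i₀ ∧ (l : ℤ) ∣ z i₁).card : ℝ) ≤ T.card * (2 / (y + 1)) := by
    calc ((A.biUnion fun l => (boxPoints L u R).filter fun z =>
          (l : ℤ) ∣ z i₀ ∧ (l : ℤ) ∣ z i₁).card : ℝ)
        ≤ ∑ l ∈ A, (((boxPoints L u R).filter fun z =>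
          (l : ℤ) ∣ z i₀ ∧ (l : ℤ) ∣ z i₁).card : ℝ) := by exact_mod_cast Finset.card_biUnion_le
      _ ≤ ∑ l ∈ A, T.card * ((l : ℝ) ^ 2)⁻¹ := by
          refine Finset.sum_le_sum fun l hl => ?_
          obtain ⟨hl1, hl2, hl3⟩ := Finset.mem_filter.1 hl
          have hlX := (Finset.mem_Ioo.1 hl1).2
          have : l ^ 2 * _ ≤ T.card := hc.sq_mul_card_dvd_le hl2 hl3 hi u
            (le_trans (Nat.mul_le_mul_right _ (by omega)) hR)
          have hlpos : (0 : ℝ) < (l : ℝ) ^ 2 := by have := hl2.pos; positivity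
          rw [← div_eq_mul_inv, le_div_iff₀ hlpos, mul_comm]
          exact_mod_cast this
      _ ≤ ∑ l ∈ Finset.Ioo y X, T.card * ((l : ℝ) ^ 2)⁻¹ :=
          Finset.sum_le_sum_of_subset_of_nonneg (Finset.filter_subset _ _)
            fun _ _ _ => by positivity
      _ ≤ _ := by
          rw [← Finset.mul_sum]
          exact mul_le_mul_of_nonneg_left (sum_Ioo_inv_sq_le y X) (by positivity)
  rw [mul_add]
  refine le_trans ?_ (add_le_add hAle hBle)
  exact_mod_cast (Finset.card_le_card hsub).trans (Finset.card_union_le _ _)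

open Classical in
/-- The sum of `1 / l` over the points of a coset of `L` in a box and over the primes `l` outside
the index of `L` that divide a given coordinate. -/
theorem Covers.sum_inv_primeFactors_le (hc : Covers L ρ) {X R K y : ℕ}
    (hX : 1 ≤ X) (i₀ : ι) (u : ι → ℤ) (hR : X * (2 * ρ + 1) ≤ R)
    (hK : R < 2 ^ K) (hy : ∀ l : ℕ, l.Prime → l ≤ y → l ∣ L.index) :
    (∑ z ∈ boxPoints L u R,
      ∑ l ∈ (z i₀).natAbs.primeFactors.filter (fun l => ¬ l ∣ L.index), ((l : ℝ))⁻¹) ≤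
      (boxPoints L u (2 * R)).card * (2 / (y + 1) + K / X) := by
  set T := boxPoints L u (2 * R)
  set A := (Finset.Ioo y X).filter fun l => l.Prime ∧ ¬ l ∣ L.index with hA
  have hXpos : (0 : ℝ) < X := by exact_mod_cast hX
  have hST : ((boxPoints L u R).card : ℝ) ≤ T.card := by
    exact_mod_cast card_boxPoints_mono u (by omega)
  have hpt : ∀ z ∈ boxPoints L u R,
      (∑ l ∈ (z i₀).natAbs.primeFactors.filter (fun l => ¬ l ∣ L.index), ((l : ℝ))⁻¹) ≤
        K / X + ∑ l ∈ A, if (l : ℤ) ∣ z i₀ then ((l : ℝ))⁻¹ else 0 := by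
    intro z hz
    rw [← Finset.sum_filter_add_sum_filter_not _ (fun l => X ≤ l)]
    refine add_le_add ?_ ?_
    · calc _ ≤ ∑ l ∈ ((z i₀).natAbs.primeFactors.filter (fun l => ¬ l ∣ L.index)).filter
            (fun l => X ≤ l), ((X : ℝ))⁻¹ := by
            refine Finset.sum_le_sum fun l hl => ?_
            have : (X : ℝ) ≤ l := by exact_mod_cast (Finset.mem_filter.1 hl).2
            gcongr
        _ ≤ K * ((X : ℝ))⁻¹ := by
            rw [Finset.sum_const, nsmul_eq_mul]
            gcongr
            refine (Finset.card_filter_le _ _).trans ((Finset.card_filter_le _ _).trans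
              (card_primeFactors_le_of_lt_two_pow (lt_of_le_of_lt ?_ hK)))
            have := (mem_boxPoints.1 hz).1 i₀
            rw [Int.abs_eq_natAbs] at this
            exact_mod_cast this
        _ = _ := (div_eq_mul_inv _ _).symm
    · rw [← Finset.sum_filter]
      refine Finset.sum_le_sum_of_subset_of_nonneg ?_ fun _ _ _ => by positivity
      intro l hl
      simp only [Finset.mem_filter, Nat.mem_primeFactors, hA, Finset.mem_Ioo] at hl ⊢
      obtain ⟨⟨⟨hl1, hl2, -⟩, hl3⟩, hl4⟩ := hl
      refine ⟨⟨⟨?_, by omega⟩, hl1, hl3⟩, by rwa [Int.natCast_dvd]⟩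
      by_contra! h
      exact hl3 (hy l hl1 h)
  calc _ ≤ ∑ z ∈ boxPoints L u R, ((K : ℝ) / X +
        ∑ l ∈ A, if (l : ℤ) ∣ z i₀ then ((l : ℝ))⁻¹ else 0) := Finset.sum_le_sum hpt
    _ = (boxPoints L u R).card * ((K : ℝ) / X) + ∑ l ∈ A,
        (((boxPoints L u R).filter fun z => (l : ℤ) ∣ z i₀).card : ℝ) * ((l : ℝ))⁻¹ := by
        rw [Finset.sum_add_distrib, Finset.sum_const, nsmul_eq_mul, Finset.sum_comm]
        congr 1
        refine Finset.sum_congr rfl fun l _ => ?_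
        rw [← Finset.sum_filter, Finset.sum_const, nsmul_eq_mul]
    _ ≤ T.card * ((K : ℝ) / X) + ∑ l ∈ A, T.card * ((l : ℝ) ^ 2)⁻¹ := by
        refine add_le_add (by gcongr) (Finset.sum_le_sum fun l hl => ?_)
        obtain ⟨hl1, hl2, hl3⟩ := Finset.mem_filter.1 hl
        have hlX := (Finset.mem_Ioo.1 hl1).2
        have : l * _ ≤ T.card := hc.mul_card_dvd_le hl2 hl3 i₀ u le_rfl
          (le_trans (Nat.mul_le_mul_right _ hlX.le) hR)
        have hlpos : (0 : ℝ) < l := by exact_mod_cast hl2.pos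
        rw [sq, mul_inv, ← mul_assoc]
        gcongr
        rw [← div_eq_mul_inv, le_div_iff₀ hlpos, mul_comm]
        exact_mod_cast this
    _ ≤ T.card * ((K : ℝ) / X) + ∑ l ∈ Finset.Ioo y X, T.card * ((l : ℝ) ^ 2)⁻¹ := by
        gcongr
        exact Finset.filter_subset _ _
    _ ≤ T.card * ((K : ℝ) / X) + T.card * (2 / (y + 1)) := by
        rw [← Finset.mul_sum]
        gcongr
        exact sum_Ioo_inv_sq_le y X
    _ = _ := by ring

end Sieve

/-! ### The lattice of approximations -/

section Congruence

variable {p : ℕ} [Fact p.Prime] {κ : Type*}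

/-- The homomorphism `(q, b) ↦ (q mod P, (q ξ_i - b_i mod p ^ s_i)_i)` whose kernel is the lattice
of approximations to `ξ`. -/
noncomputable def approxHom (P : ℕ) (s : κ → ℕ) (ξ : κ → ℤ_[p]) :
    (Option κ → ℤ) →+ ZMod P × ((i : κ) → ZMod (p ^ s i)) where
  toFun z := ((z none : ZMod P), fun i =>
    PadicInt.toZModPow (s i) ((z none : ℤ_[p]) * ξ i - (z (some i) : ℤ_[p])))
  map_zero' := by ext <;> simp
  map_add' x y := by
    ext i
    · simp
    · simp only [Pi.add_apply, Int.cast_add, Prod.snd_add, ← map_add]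
      congr 1
      ring

/-- The lattice of integer vectors `(q, b)` with `P ∣ q` and `q ξ_i ≡ b_i` modulo `p ^ s_i` for
every `i`. The coordinate `none` is `q`. -/
noncomputable def approxLattice (P : ℕ) (s : κ → ℕ) (ξ : κ → ℤ_[p]) : AddSubgroup (Option κ → ℤ) :=
  (approxHom P s ξ).ker

theorem toZModPow_eq_zero_iff {n : ℕ} {x : ℤ_[p]} :
    PadicInt.toZModPow n x = 0 ↔ ‖x‖ ≤ (p : ℝ) ^ (-n : ℤ) := by
  rw [PadicInt.norm_le_pow_iff_mem_span_pow, ← PadicInt.ker_toZModPow, RingHom.mem_ker]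

theorem mem_approxLattice {P : ℕ} {s : κ → ℕ} {ξ : κ → ℤ_[p]} {z : Option κ → ℤ} :
    z ∈ approxLattice P s ξ ↔ (P : ℤ) ∣ z none ∧
      ∀ i, ‖(z none : ℤ_[p]) * ξ i - (z (some i) : ℤ_[p])‖ ≤ (p : ℝ) ^ (-s i : ℤ) := by
  rw [approxLattice, AddMonoidHom.mem_ker]
  simp only [approxHom, AddMonoidHom.coe_mk, ZeroHom.coe_mk, Prod.ext_iff, Prod.fst_zero,
    Prod.snd_zero, funext_iff, Pi.zero_apply, toZModPow_eq_zero_iff,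
    ZMod.intCast_zmod_eq_zero_iff_dvd]

theorem index_approxLattice [Fintype κ] (P : ℕ) (s : κ → ℕ) (ξ : κ → ℤ_[p]) :
    (approxLattice P s ξ).index = P * ∏ i, p ^ s i := by
  have hsurj : Function.Surjective (approxHom P s ξ) := by
    rintro ⟨a, b⟩
    obtain ⟨q, rfl⟩ := ZMod.intCast_surjective a
    have : ∀ i, ∃ c : ℤ, (c : ZMod (p ^ s i)) =
        PadicInt.toZModPow (s i) ((q : ℤ_[p]) * ξ i) - b i := fun i => ZMod.intCast_surjective _
    choose c hc using this
    refine ⟨fun o => o.elim q c, ?_⟩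
    ext i
    · simp [approxHom]
    · simp only [approxHom, AddMonoidHom.coe_mk, ZeroHom.coe_mk, Option.elim, map_sub, map_intCast,
        hc]
      abel
  rw [approxLattice, AddSubgroup.index_ker, AddMonoidHom.range_eq_top.2 hsurj,
    Nat.card_congr AddSubgroup.topEquiv.toEquiv, Nat.card_prod, Nat.card_zmod, Nat.card_pi]
  simp

end Congruence

/-! ### Haar measure of neighbourhoods of fractions -/

section Measure

variable {p : ℕ} [Fact p.Prime]

theorem prime_cast_pos : (0 : ℝ) < p := by exact_mod_cast (Fact.out : p.Prime).pos

theorem norm_le_zpow_iff_dvd {x : ℤ_[p]} {n : ℕ} :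
    ‖x‖ ≤ (p : ℝ) ^ (-n : ℤ) ↔ (p : ℤ_[p]) ^ n ∣ x := by
  rw [PadicInt.norm_le_pow_iff_mem_span_pow, Ideal.mem_span_singleton]

theorem norm_sub_le_max_padicInt (x y : ℤ_[p]) : ‖x - y‖ ≤ max ‖x‖ ‖y‖ := by
  simpa [sub_eq_add_neg] using PadicInt.nonarchimedean x (-y)

theorem haar1_real_closedBall (x : ℤ_[p]) (k : ℕ) :
    (haar1 p).real (Metric.closedBall x ((p : ℝ) ^ (-k : ℤ))) = (p : ℝ) ^ (-k : ℤ) := by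
  have hp := prime_cast_pos (p := p)
  have hc : ∀ y : ℤ_[p], (haar1 p).real (Metric.closedBall y ((p : ℝ) ^ (-k : ℤ))) =
      (haar1 p).real (Metric.closedBall 0 ((p : ℝ) ^ (-k : ℤ))) := fun y => by
    simp only [Measure.real]
    rw [Measure.addHaar_closedBall_center]
  have : NeZero (p ^ k) := ⟨pow_ne_zero _ (Fact.out : p.Prime).ne_zero⟩
  have hmem : ∀ (a : ZMod (p ^ k)) (y : ℤ_[p]),
      y ∈ Metric.closedBall ((a.val : ℕ) : ℤ_[p]) ((p : ℝ) ^ (-k : ℤ)) ↔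
        PadicInt.toZModPow k y = a := by
    intro a y
    rw [mem_closedBall_iff_norm, ← toZModPow_eq_zero_iff, map_sub, map_natCast,
      ZMod.natCast_zmod_val, sub_eq_zero]
  have hU : (⋃ a : ZMod (p ^ k), Metric.closedBall ((a.val : ℕ) : ℤ_[p]) ((p : ℝ) ^ (-k : ℤ))) =
      Set.univ := by
    refine Set.eq_univ_of_forall fun y => Set.mem_iUnion.2 ⟨PadicInt.toZModPow k y, ?_⟩
    rw [hmem]
  have h1 := measureReal_iUnion_fintype (μ := haar1 p)
    (f := fun a : ZMod (p ^ k) => Metric.closedBall ((a.val : ℕ) : ℤ_[p]) ((p : ℝ) ^ (-k : ℤ)))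
    (fun a b hab => Set.disjoint_left.2 fun y hy hy' =>
      hab (((hmem a y).1 hy).symm.trans ((hmem b y).1 hy')))
    (fun a => Metric.isClosed_closedBall.measurableSet)
  rw [hU, Finset.sum_congr rfl (fun a _ => hc _), Finset.sum_const, Finset.card_univ, ZMod.card,
    nsmul_eq_mul] at h1
  have h2 : (haar1 p).real Set.univ = 1 := by simp [Measure.real]
  rw [hc, zpow_neg, zpow_natCast]
  rw [h2, zpow_neg, zpow_natCast] at h1
  push_cast at h1
  exact eq_inv_of_mul_eq_one_right h1.symm

/-- Every open ball of `ℤ_p ^ d` is a product of closed balls of radius a power of `p`. -/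
theorem exists_ball_eq_pi (d : ℕ) {r : ℝ} (hr : 0 < r) :
    ∃ t : ℕ, ∀ x : Fin d → ℤ_[p], Metric.ball x r =
      Set.univ.pi fun i => Metric.closedBall (x i) ((p : ℝ) ^ (-t : ℤ)) := by
  classical
  have hex := PadicInt.exists_pow_neg_lt p hr
  refine ⟨Nat.find hex, fun x => ?_⟩
  have hspec := Nat.find_spec hex
  have hmin := fun k => Nat.find_min (m := k) hex
  generalize Nat.find hex = t at *
  ext y
  rw [Metric.mem_ball, dist_pi_lt_iff hr, Set.mem_univ_pi]
  refine forall_congr' fun i => ?_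
  rw [mem_closedBall_iff_norm, dist_eq_norm]
  refine ⟨fun h => ?_, fun h => h.trans_lt hspec⟩
  rcases t with _ | t
  · simpa using PadicInt.norm_le_one (y i - x i)
  · have := hmin t (Nat.lt_succ_self t)
    have h2 := h.trans_le (not_lt.1 this)
    rw [PadicInt.norm_lt_pow_iff_norm_le_pow_sub_one] at h2
    convert h2 using 2
    push_cast; ring

theorem haar_real_pi (d : ℕ) (S : Fin d → Set ℤ_[p]) :
    (haar p d).real (Set.univ.pi S) = ∏ i, (haar1 p).real (S i) := by
  simp only [Measure.real, haar, Measure.pi_pi, ENNReal.toReal_prod]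

theorem card_le_div_add_one {A : Finset ℤ} {m R : ℕ} (hm : 0 < m) (hA : ∀ a ∈ A, |a| ≤ R)
    (hd : ∀ a ∈ A, ∀ b ∈ A, (m : ℤ) ∣ a - b) : (A.card : ℝ) ≤ 2 * R / m + 1 := by
  rcases A.eq_empty_or_nonempty with rfl | hne
  · simp only [Finset.card_empty, Nat.cast_zero]; positivity
  set a₀ := A.min' hne
  have ha₀ : a₀ ∈ A := A.min'_mem hne
  have hle : ∀ a ∈ A, a₀ ≤ a := fun a ha => A.min'_le a ha
  have hmz : (0 : ℤ) < m := by exact_mod_cast hm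
  have : A.card ≤ (Finset.range (2 * R / m + 1)).card := by
    refine Finset.card_le_card_of_injOn (fun a => ((a - a₀) / m).toNat) ?_ ?_
    · intro a ha
      have h1 := hle a ha
      have h2 := abs_le.1 (hA a ha)
      have h3 := abs_le.1 (hA a₀ ha₀)
      have h4 : (a - a₀) / (m : ℤ) ≤ (2 * R : ℤ) / m := Int.ediv_le_ediv hmz (by linarith)
      have h5 : 0 ≤ (a - a₀) / (m : ℤ) := Int.ediv_nonneg (by linarith) hmz.le
      simp only [Finset.coe_range, Set.mem_Iio]
      zify
      rw [Int.toNat_of_nonneg h5]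
      omega
    · intro a ha b hb hab
      have h5 : 0 ≤ (a - a₀) / (m : ℤ) := Int.ediv_nonneg (by linarith [hle a ha]) hmz.le
      have h6 : 0 ≤ (b - a₀) / (m : ℤ) := Int.ediv_nonneg (by linarith [hle b hb]) hmz.le
      have hab' : ((a - a₀) / (m : ℤ)) = (b - a₀) / (m : ℤ) := by
        have : ((a - a₀) / (m : ℤ)).toNat = ((b - a₀) / (m : ℤ)).toNat := hab
        omega
      have := (Int.ediv_left_inj (hd a ha a₀ ha₀) (hd b hb a₀ ha₀)).1 hab'
      linarith
  rw [Finset.card_range] at this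
  calc (A.card : ℝ) ≤ ((2 * R / m : ℕ) : ℝ) + 1 := by exact_mod_cast this
    _ ≤ _ := by
      gcongr
      refine Nat.cast_div_le.trans (le_of_eq ?_)
      push_cast; ring

/-- The part of the ball of radius `p ^ (-t)` about `x₀` that is close to a fraction `a / q` with
`|a| ≤ R` and `D ∣ a`. The numerators that matter are congruent modulo `D p ^ (t + e)`, where
`p ^ e` is the `p`-part of `q`. -/
theorem haar1_real_approx_le {q : ℤ} {e t r D R : ℕ}
    (he : ‖(q : ℤ_[p])‖ = (p : ℝ) ^ (-e : ℤ)) (hr : t + e ≤ r) (hD : 0 < D)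
    (hDp : D.Coprime p) (x₀ : ℤ_[p]) :
    (haar1 p).real {x | x ∈ Metric.closedBall x₀ ((p : ℝ) ^ (-t : ℤ)) ∧ ∃ a : ℤ, |a| ≤ R ∧
      (D : ℤ) ∣ a ∧ ‖(q : ℤ_[p]) * x - a‖ ≤ (p : ℝ) ^ (-r : ℤ)} ≤
      (2 * R / (D * (p : ℝ) ^ t) + (p : ℝ) ^ e) * (p : ℝ) ^ (-r : ℤ) := by
  classical
  have hp := prime_cast_pos (p := p)
  have hp1 : (1 : ℝ) ≤ p := by exact_mod_cast (Fact.out : p.Prime).one_lt.le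
  set A := (Finset.Icc (-(R : ℤ)) R).filter fun a => (D : ℤ) ∣ a ∧
    ∃ x ∈ Metric.closedBall x₀ ((p : ℝ) ^ (-t : ℤ)),
      ‖(q : ℤ_[p]) * x - a‖ ≤ (p : ℝ) ^ (-r : ℤ) with hA
  have hex : ∀ a : ℤ, ∃ x : ℤ_[p], a ∈ A → x ∈ Metric.closedBall x₀ ((p : ℝ) ^ (-t : ℤ)) ∧
      ‖(q : ℤ_[p]) * x - a‖ ≤ (p : ℝ) ^ (-r : ℤ) := by
    intro a
    by_cases ha : a ∈ A
    · obtain ⟨x, hx⟩ := (Finset.mem_filter.1 ha).2.2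
      exact ⟨x, fun _ => hx⟩
    · exact ⟨0, fun h => absurd h ha⟩
  choose c hc using hex
  have hsub : {x | x ∈ Metric.closedBall x₀ ((p : ℝ) ^ (-t : ℤ)) ∧ ∃ a : ℤ, |a| ≤ R ∧
      (D : ℤ) ∣ a ∧ ‖(q : ℤ_[p]) * x - a‖ ≤ (p : ℝ) ^ (-r : ℤ)} ⊆
      ⋃ a ∈ A, Metric.closedBall (c a) ((p : ℝ) ^ (-(r - e : ℕ) : ℤ)) := by
    rintro x ⟨hx, a, haR, hDa, hxa⟩
    have haA : a ∈ A := Finset.mem_filter.2 ⟨Finset.mem_Icc.2 (abs_le.1 haR), hDa, x, hx, hxa⟩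
    refine Set.mem_biUnion haA ?_
    rw [mem_closedBall_iff_norm]
    have h1 : ‖(q : ℤ_[p]) * (x - c a)‖ ≤ (p : ℝ) ^ (-r : ℤ) := by
      have : (q : ℤ_[p]) * (x - c a) = (q * x - a) - (q * c a - a) := by ring
      rw [this]
      exact (norm_sub_le_max_padicInt _ _).trans (max_le hxa (hc a haA).2)
    rw [norm_mul, he] at h1
    have h2 : (p : ℝ) ^ (-r : ℤ) = (p : ℝ) ^ (-e : ℤ) * (p : ℝ) ^ (-(r - e : ℕ) : ℤ) := by
      rw [← zpow_add₀ hp.ne']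
      congr 1
      push_cast [show e ≤ r by omega]; ring
    rw [h2] at h1
    exact le_of_mul_le_mul_left h1 (by positivity)
  have hcard : (A.card : ℝ) ≤ 2 * R / ((D * p ^ (t + e) : ℕ) : ℝ) + 1 := by
    refine card_le_div_add_one ?_ (fun a ha => ?_) fun a ha b hb => ?_
    · exact Nat.mul_pos hD (pow_pos (Fact.out : p.Prime).pos _)
    · exact abs_le.2 (Finset.mem_Icc.1 (Finset.mem_filter.1 ha).1)
    · have hcop : IsCoprime (D : ℤ) ((p ^ (t + e) : ℕ) : ℤ) :=
        Nat.isCoprime_iff_coprime.2 (hDp.pow_right _)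
      push_cast at hcop ⊢
      refine hcop.mul_dvd (dvd_sub (Finset.mem_filter.1 ha).2.1 (Finset.mem_filter.1 hb).2.1) ?_
      rw [← PadicInt.norm_int_le_pow_iff_dvd (p := p)]
      have h0 : ((a - b : ℤ) : ℤ_[p]) = (q * c b - b) - (q * c a - a) + q * (c a - c b) := by
        push_cast; ring
      have hpow : (p : ℝ) ^ (-r : ℤ) ≤ (p : ℝ) ^ (-(t + e : ℕ) : ℤ) :=
        zpow_le_zpow_right₀ hp1 (by omega)
      have h1 : ‖c a - c b‖ ≤ (p : ℝ) ^ (-t : ℤ) := by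
        have : c a - c b = (c a - x₀) - (c b - x₀) := by ring
        rw [this]
        exact (norm_sub_le_max_padicInt _ _).trans
          (max_le (mem_closedBall_iff_norm.1 (hc a ha).1) (mem_closedBall_iff_norm.1 (hc b hb).1))
      rw [h0]
      refine (PadicInt.nonarchimedean _ _).trans (max_le
        ((norm_sub_le_max_padicInt _ _).trans
          (max_le ((hc b hb).2.trans hpow) ((hc a ha).2.trans hpow))) ?_)
      rw [norm_mul, he]
      calc (p : ℝ) ^ (-e : ℤ) * ‖c a - c b‖ ≤ (p : ℝ) ^ (-e : ℤ) * (p : ℝ) ^ (-t : ℤ) := by gcongr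
        _ = _ := by
          rw [← zpow_add₀ hp.ne']
          congr 1
          push_cast; ring
  calc _ ≤ (haar1 p).real (⋃ a ∈ A, Metric.closedBall (c a) ((p : ℝ) ^ (-(r - e : ℕ) : ℤ))) :=
        measureReal_mono hsub (measure_ne_top _ _)
    _ ≤ ∑ a ∈ A, (haar1 p).real (Metric.closedBall (c a) ((p : ℝ) ^ (-(r - e : ℕ) : ℤ))) :=
        measureReal_biUnion_finset_le _ _
    _ = A.card * (p : ℝ) ^ (-(r - e : ℕ) : ℤ) := by
        rw [Finset.sum_congr rfl fun a _ => haar1_real_closedBall (c a) (r - e), Finset.sum_const,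
          nsmul_eq_mul]
    _ ≤ (2 * R / ((D * p ^ (t + e) : ℕ) : ℝ) + 1) * (p : ℝ) ^ (-(r - e : ℕ) : ℤ) := by gcongr
    _ = _ := by
        have h2 : (p : ℝ) ^ (-(r - e : ℕ) : ℤ) = (p : ℝ) ^ e * (p : ℝ) ^ (-r : ℤ) := by
          rw [← zpow_natCast, ← zpow_add₀ hp.ne']
          congr 1
          push_cast [show e ≤ r by omega]; ring
        have hD' : (D : ℝ) ≠ 0 := by exact_mod_cast hD.ne'
        rw [h2, ← mul_assoc]
        congr 1
        push_cast
        rw [pow_add]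
        field_simp

/-- If every point of `U` lies in a box of side `p ^ (-r)` whose concentric box of side
`p ^ (-(r + κ))` is contained in `V`, then `U` is covered by `p ^ (κ d)` translates of `V`. -/
theorem haar_real_le_of_coarse {d : ℕ} {r : Fin d → ℕ} {κ : ℕ} {U V : Set (Fin d → ℤ_[p])}
    (h : ∀ x ∈ U, ∃ c : Fin d → ℤ_[p], (∀ j, ‖x j - c j‖ ≤ (p : ℝ) ^ (-r j : ℤ)) ∧
      ∀ y : Fin d → ℤ_[p], (∀ j, ‖y j - c j‖ ≤ (p : ℝ) ^ (-(r j + κ : ℕ) : ℤ)) → y ∈ V) :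
    (haar p d).real U ≤ (p : ℝ) ^ (κ * d) * (haar p d).real V := by
  have : (haar p d).IsAddHaarMeasure := haar_isAddHaarMeasure p d
  have : IsProbabilityMeasure (haar p d) := ⟨haar_univ p d⟩
  have hpne : NeZero (p ^ κ) := ⟨pow_ne_zero _ (Fact.out : p.Prime).ne_zero⟩
  let f : (Fin d → ZMod (p ^ κ)) → Fin d → ℤ_[p] := fun u j =>
    -((p : ℤ_[p]) ^ r j * ((u j).val : ℤ_[p]))
  have hsub : U ⊆ ⋃ u : Fin d → ZMod (p ^ κ), (fun y => f u + y) ⁻¹' V := by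
    intro x hx
    obtain ⟨c, hc, hV⟩ := h x hx
    have hw : ∀ j, ∃ w, x j - c j = (p : ℤ_[p]) ^ r j * w := fun j => norm_le_zpow_iff_dvd.1 (hc j)
    choose w hw using hw
    refine Set.mem_iUnion.2 ⟨fun j => PadicInt.toZModPow κ (w j), hV _ fun j => ?_⟩
    have e1 : (f (fun j => PadicInt.toZModPow κ (w j)) + x) j - c j =
        (p : ℤ_[p]) ^ r j * (w j - ((PadicInt.toZModPow κ (w j)).val : ℤ_[p])) := by
      simp only [f, Pi.add_apply]
      linear_combination hw j
    rw [e1, norm_le_zpow_iff_dvd, pow_add]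
    refine mul_dvd_mul_left _ ?_
    rw [← norm_le_zpow_iff_dvd, ← toZModPow_eq_zero_iff, map_sub, map_natCast,
      ZMod.natCast_zmod_val, sub_self]
  calc (haar p d).real U ≤ _ := measureReal_mono hsub
    _ ≤ ∑ u : Fin d → ZMod (p ^ κ), (haar p d).real ((fun y => f u + y) ⁻¹' V) :=
        measureReal_iUnion_fintype_le _
    _ = ∑ u : Fin d → ZMod (p ^ κ), (haar p d).real V := by
        refine Finset.sum_congr rfl fun u _ => ?_
        simp only [Measure.real, measure_preimage_add]
    _ = _ := by
        rw [Finset.sum_const, Finset.card_univ, Fintype.card_fun, ZMod.card, Fintype.card_fin,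
          nsmul_eq_mul, pow_mul]
        push_cast
        rfl

end Measure

/-! ### Approximable points and the exceptional sets -/

section Exceptional

variable {p : ℕ} [Fact p.Prime]

/-- The vector `(1, b)` with `b_i ≡ ξ_i` modulo `p ^ s_i`. The coset of `approxLattice P s ξ` that
contains it consists of the approximations `(q, b)` to `ξ` with `q ≡ 1` modulo `P`. -/
noncomputable def unitVec {κ : Type*} (s : κ → ℕ) (ξ : κ → ℤ_[p]) : Option κ → ℤ :=
  fun o => o.elim 1 fun i => ((ξ i).appr (s i) : ℤ)

theorem sub_unitVec_mem {κ : Type*} {P : ℕ} {s : κ → ℕ} {ξ : κ → ℤ_[p]} {z : Option κ → ℤ} :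
    z - unitVec s ξ ∈ approxLattice P s ξ ↔ (P : ℤ) ∣ z none - 1 ∧
      ∀ i, ‖(z none : ℤ_[p]) * ξ i - (z (some i) : ℤ_[p])‖ ≤ (p : ℝ) ^ (-s i : ℤ) := by
  rw [mem_approxLattice]
  refine and_congr Iff.rfl (forall_congr' fun i => ?_)
  rw [← toZModPow_eq_zero_iff, ← toZModPow_eq_zero_iff]
  have h1 : PadicInt.toZModPow (s i) (ξ i - ((ξ i).appr (s i) : ℤ_[p])) = 0 := by
    rw [toZModPow_eq_zero_iff, PadicInt.norm_le_pow_iff_mem_span_pow]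
    exact PadicInt.appr_spec _ _
  have h2 : (((z - unitVec s ξ) none : ℤ) : ℤ_[p]) * ξ i -
      (((z - unitVec s ξ) (some i) : ℤ) : ℤ_[p]) =
      ((z none : ℤ_[p]) * ξ i - (z (some i) : ℤ_[p])) - (ξ i - ((ξ i).appr (s i) : ℤ_[p])) := by
    simp only [unitVec, Pi.sub_apply, Option.elim]
    push_cast
    ring
  rw [h2, map_sub, h1, sub_zero]

variable {d m : ℕ}

/-- The points of the ball of radius `p ^ (-t)` about `x₀` that are close to a point `a / q` with
`|a_j| ≤ R` and `D_j ∣ a_j` for every `j`. -/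
def approxBox (x₀ : Fin d → ℤ_[p]) (t : ℕ) (r : Fin d → ℕ) (q : ℤ) (R : ℕ) (D : Fin d → ℕ) :
    Set (Fin d → ℤ_[p]) :=
  Set.univ.pi fun j => {x | x ∈ Metric.closedBall (x₀ j) ((p : ℝ) ^ (-t : ℤ)) ∧ ∃ a : ℤ, |a| ≤ R ∧
      (D j : ℤ) ∣ a ∧ ‖(q : ℤ_[p]) * x - a‖ ≤ (p : ℝ) ^ (-r j : ℤ)}

/-- The condition `p ^ (t + e) ≤ R`, where `p ^ e` is the `p`-part of `q`, ensures that the fractions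
with numerators at most `R` are evenly spread over the ball. -/
theorem real_approxBox_le {x₀ : Fin d → ℤ_[p]} {t : ℕ} {r : Fin d → ℕ} {q : ℤ} {R : ℕ} {e : ℕ}
    (he : ‖(q : ℤ_[p])‖ = (p : ℝ) ^ (-e : ℤ)) (hR : p ^ (t + e) ≤ R) (hr : ∀ j, R ≤ p ^ r j) :
    (haar p d).real (approxBox x₀ t r q R fun _ => 1) ≤
      (3 * R) ^ d * ((p : ℝ) ^ t)⁻¹ ^ d * (∏ j, (p : ℝ) ^ r j)⁻¹ := by
  have hp := prime_cast_pos (p := p)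
  rw [approxBox, haar_real_pi]
  calc _ ≤ ∏ j, ((3 * R : ℝ) * ((p : ℝ) ^ t)⁻¹ * ((p : ℝ) ^ r j)⁻¹) := by
        refine Finset.prod_le_prod (fun j _ => measureReal_nonneg) fun j _ => ?_
        have hte : t + e ≤ r j :=
          (Nat.pow_le_pow_iff_right (Fact.out : p.Prime).one_lt).1 (hR.trans (hr j))
        refine (haar1_real_approx_le he hte one_pos (Nat.coprime_one_left p) (x₀ j)).trans ?_
        rw [zpow_neg, zpow_natCast]
        gcongr
        have h1 : (p : ℝ) ^ t * (p : ℝ) ^ e ≤ R := by rw [← pow_add]; exact_mod_cast hR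
        rw [Nat.cast_one, one_mul, ← div_eq_mul_inv, div_add' _ _ _ (by positivity)]
        gcongr
        linarith
    _ = _ := by
        rw [Finset.prod_mul_distrib, Finset.prod_const, Finset.card_univ, Fintype.card_fin,
          Finset.prod_inv_distrib, mul_pow]

theorem norm_eq_of_not_dvd {q : ℤ} (hq : ¬ (p : ℤ) ∣ q) :
    ‖(q : ℤ_[p])‖ = (p : ℝ) ^ (-(0 : ℕ) : ℤ) := by
  simp only [Nat.cast_zero, neg_zero, zpow_zero]
  exact le_antisymm (PadicInt.norm_le_one _)
    (not_lt.1 fun h => hq ((PadicInt.norm_int_lt_one_iff_dvd q).1 h))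

/-- Divisibility of one numerator by a prime `l ≠ p` saves a factor `1 / l`, up to the error of
counting the numerators. -/
theorem real_approxBox_update_le {x₀ : Fin d → ℤ_[p]} {t : ℕ} {r : Fin d → ℕ} {q : ℤ} {R : ℕ}
    (hq : ¬ (p : ℤ) ∣ q) (hR : p ^ t ≤ R) (hr : ∀ j, R ≤ p ^ r j) {l : ℕ} (hl : l.Prime)
    (hlp : l ≠ p) (j₀ : Fin d) :
    (haar p d).real (approxBox x₀ t r q R (Function.update (fun _ => 1) j₀ l)) ≤
      (3 * R) ^ d * ((p : ℝ) ^ t)⁻¹ ^ d * (∏ j, (p : ℝ) ^ r j)⁻¹ *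
        ((l : ℝ)⁻¹ + (p : ℝ) ^ t / R) := by
  classical
  have hp := prime_cast_pos (p := p)
  have he := norm_eq_of_not_dvd hq
  have hRpos : (0 : ℝ) < R := by
    exact_mod_cast (pow_pos (Fact.out : p.Prime).pos t).trans_le hR
  have hlpos : (0 : ℝ) < l := by exact_mod_cast hl.pos
  have h1 : (p : ℝ) ^ t ≤ R := by exact_mod_cast hR
  rw [approxBox, haar_real_pi]
  calc _ ≤ ∏ j, (((3 * R : ℝ) * ((p : ℝ) ^ t)⁻¹ * ((p : ℝ) ^ r j)⁻¹) *
        if j = j₀ then ((l : ℝ)⁻¹ + (p : ℝ) ^ t / R) else 1) := by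
        refine Finset.prod_le_prod (fun j _ => measureReal_nonneg) fun j _ => ?_
        have hte : t + 0 ≤ r j :=
          (Nat.pow_le_pow_iff_right (Fact.out : p.Prime).one_lt).1 (hR.trans (hr j))
        by_cases hj : j = j₀
        · subst hj
          rw [Function.update_self, if_pos rfl]
          refine (haar1_real_approx_le he hte hl.pos
            ((Nat.coprime_primes hl Fact.out).2 hlp) (x₀ j)).trans ?_
          rw [zpow_neg, zpow_natCast, mul_right_comm]
          gcongr
          have : 3 * R * ((p : ℝ) ^ t)⁻¹ * ((l : ℝ)⁻¹ + (p : ℝ) ^ t / R) =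
              3 * R / (l * (p : ℝ) ^ t) + 3 := by field_simp
          rw [this, pow_zero]
          have : 2 * R / (l * (p : ℝ) ^ t) ≤ 3 * R / (l * (p : ℝ) ^ t) := by gcongr; norm_num
          linarith
        · rw [Function.update_of_ne hj, if_neg hj, mul_one]
          refine (haar1_real_approx_le he hte one_pos (Nat.coprime_one_left p) (x₀ j)).trans ?_
          rw [zpow_neg, zpow_natCast]
          gcongr
          rw [Nat.cast_one, one_mul, ← div_eq_mul_inv, div_add' _ _ _ (by positivity), pow_zero]
          gcongr
          linarith
    _ = _ := by
        rw [Finset.prod_mul_distrib, Finset.prod_ite_eq' Finset.univ j₀, if_pos (Finset.mem_univ _),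
          Finset.prod_mul_distrib, Finset.prod_const, Finset.card_univ, Fintype.card_fin,
          Finset.prod_inv_distrib, mul_pow]

/-- A point `x` of `ℤ_p ^ d` is well approximable at height `N`, jointly with `α`, if some integer
`q ∈ [N / 2, N)` prime to `p` is the denominator of reduced fractions that approximate each
coordinate of `x` to the precision `r` and each coordinate of `α` to the precision `s`. -/
def IsApproximable (α : Fin m → ℤ_[p]) (s : Fin m → ℕ) (r : Fin d → ℕ) (N : ℕ)
    (x : Fin d → ℤ_[p]) : Prop :=
  ∃ q : ℕ, N ≤ 2 * q ∧ q < N ∧ ¬ p ∣ q ∧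
    (∀ j, ∃ a : ℤ, |a| ≤ q ∧ IsCoprime a (q : ℤ) ∧
      ‖(q : ℤ_[p]) * x j - a‖ ≤ (p : ℝ) ^ (-r j : ℤ)) ∧
    ∀ i, ∃ b : ℤ, |b| ≤ q ∧ IsCoprime b (q : ℤ) ∧
      ‖(q : ℤ_[p]) * α i - b‖ ≤ (p : ℝ) ^ (-s i : ℤ)

theorem exists_prime_dvd_of_not_isCoprime {a q : ℤ} (h : ¬ IsCoprime a q) :
    ∃ l : ℕ, l.Prime ∧ (l : ℤ) ∣ q ∧ (l : ℤ) ∣ a := by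
  rw [Int.isCoprime_iff_gcd_eq_one] at h
  obtain ⟨l, hl, hd⟩ := Nat.exists_prime_and_dvd h
  exact ⟨l, hl, (Int.natCast_dvd_natCast.2 hd).trans (Int.gcd_dvd_right _ _),
    (Int.natCast_dvd_natCast.2 hd).trans (Int.gcd_dvd_left _ _)⟩

theorem eq_zero_of_norm_le {b : ℤ} {n h : ℕ} (hb : ‖(b : ℤ_[p])‖ ≤ (p : ℝ) ^ (-n : ℤ))
    (hbh : |b| < h) (hh : h ≤ p ^ n) : b = 0 := by
  rw [PadicInt.norm_int_le_pow_iff_dvd] at hb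
  refine Int.eq_zero_of_abs_lt_dvd hb (hbh.trans_le ?_)
  exact_mod_cast hh

open Classical in
/-- Outside the three exceptional sets `E₁` (the lattice of approximations to `(x, α)` has a short
vector), `E₂` (an approximation has a common prime factor of `q` and some `b_i`) and `E₃` (the same
for `q` and some `a_j`), a point of the ball is approximable: by the absence of short vectors the
lattice has a small covering radius, so the coset `q ≡ 1 (mod P)` has a point near
`(3N/4, 0, …, 0)`, and its coordinates are coprime to `q` since the small primes divide `P`. -/
theorem isApproximable_of_notMem {P : ℕ} (hpP : p ∣ P) (hP : 0 < P) {α : Fin m → ℤ_[p]}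
    {s : Fin m → ℕ} {r : Fin d → ℕ} {x₀ x : Fin d → ℤ_[p]} {t N h : ℕ} (hN : 8 ≤ N) (hh : 0 < h)
    (hhN : h ≤ N) (hs : ∀ i, N ≤ p ^ s i) (hr : ∀ j, N ≤ p ^ r j)
    (hind : P * (∏ i, p ^ s i) * ∏ j, p ^ r j ≤ N / 8 * h ^ (d + m))
    (hx : x ∈ Set.univ.pi fun j => Metric.closedBall (x₀ j) ((p : ℝ) ^ (-t : ℤ)))
    (h1 : ∀ z ∈ boxPoints (approxLattice P s α) 0 h, z none ≠ 0 →
      x ∉ approxBox x₀ t r (z none) h fun _ => 1)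
    (h2 : ∀ z ∈ boxPoints (approxLattice P s α) (unitVec s α) N, ∀ i, ∀ l : ℕ, l.Prime →
      ¬ l ∣ (approxLattice P s α).index → (l : ℤ) ∣ z none → (l : ℤ) ∣ z (some i) →
      x ∉ approxBox x₀ t r (z none) N fun _ => 1)
    (h3 : ∀ z ∈ boxPoints (approxLattice P s α) (unitVec s α) N, ∀ j, ∀ l : ℕ, l.Prime →
      ¬ l ∣ (approxLattice P s α).index → (l : ℤ) ∣ z none →
      x ∉ approxBox x₀ t r (z none) N (Function.update (fun _ => 1) j l)) :
    IsApproximable α s r N x := by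
  have hp : p.Prime := Fact.out
  set L := approxLattice P (Sum.elim r s) (Sum.elim x α) with hL
  set Λ := approxLattice P s α with hΛ
  have hLi : L.index = P * (∏ i, p ^ s i) * ∏ j, p ^ r j := by
    rw [hL, index_approxLattice, Fintype.prod_sum_type]
    simp only [Sum.elim_inl, Sum.elim_inr]
    ring
  have hLi0 : L.index ≠ 0 := by
    rw [hLi]
    have hs0 := fun i => pow_pos hp.pos (s i)
    have hr0 := fun j => pow_pos hp.pos (r j)
    have : 0 < P * (∏ i, p ^ s i) * ∏ j, p ^ r j :=
      Nat.mul_pos (Nat.mul_pos hP (Finset.prod_pos fun i _ => hs0 i))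
        (Finset.prod_pos fun j _ => hr0 j)
    omega
  -- Forgetting the coordinates `a` maps the lattice for `(x, α)` to that for `α`.
  let res : (Option (Fin d ⊕ Fin m) → ℤ) → Option (Fin m) → ℤ :=
    fun z o => o.elim (z none) fun i => z (some (Sum.inr i))
  have hmem : ∀ (z : Option (Fin d ⊕ Fin m) → ℤ) (R : ℕ) (D : Fin d → ℕ), (∀ o, |z o| ≤ R) →
      (∀ i, ‖(z none : ℤ_[p]) * Sum.elim x α i - (z (some i) : ℤ_[p])‖ ≤
        (p : ℝ) ^ (-(Sum.elim r s i : ℕ) : ℤ)) → (∀ j, (D j : ℤ) ∣ z (some (Sum.inl j))) →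
      x ∈ approxBox x₀ t r (z none) R D := by
    intro z R D hzR hz hD
    rw [approxBox, Set.mem_univ_pi]
    intro j
    exact ⟨hx j (Set.mem_univ j), z (some (Sum.inl j)), hzR _, hD j, hz (Sum.inl j)⟩
  have hmin : ∀ z ∈ L, z ≠ 0 → ∃ o, (h : ℤ) ≤ |z o| := by
    intro z hz hz0
    by_contra! hlt
    rw [hL, mem_approxLattice] at hz
    have hne : z none ≠ 0 := by
      intro h0
      refine hz0 (funext fun o => ?_)
      rcases o with _ | i
      · exact h0
      have := hz.2 i
      rw [h0, Int.cast_zero, zero_mul, zero_sub, norm_neg] at this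
      refine eq_zero_of_norm_le this (hlt _) ?_
      rcases i with j | i
      · exact hhN.trans (hr j)
      · exact hhN.trans (hs i)
    refine h1 (res z) ?_ hne (hmem z h _ (fun o => (hlt o).le) hz.2 fun _ => by simp)
    rw [mem_boxPoints, sub_zero, hΛ, mem_approxLattice]
    refine ⟨fun o => ?_, hz.1, fun i => hz.2 (Sum.inr i)⟩
    rcases o with _ | i <;> exact (hlt _).le
  have hcov : Covers L (N / 8) := by
    refine covers_of_forall_le_abs L hLi0 hh hmin ?_
    rw [hLi, Fintype.card_option, Fintype.card_sum, Fintype.card_fin, Fintype.card_fin, pow_succ,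
      ← mul_assoc]
    exact Nat.mul_le_mul_right _ hind
  -- Within `N / 8` of `3 N / 4` the denominator stays in `[N / 2, N)`, and exceeds the numerators.
  let c : Option (Fin d ⊕ Fin m) → ℤ := fun o => o.elim ((N - N / 4 : ℕ) : ℤ) fun _ => 0
  obtain ⟨w, hw, hwc⟩ := hcov (c - unitVec (Sum.elim r s) (Sum.elim x α))
  set z := w + unitVec (Sum.elim r s) (Sum.elim x α) with hz
  have hzL : z - unitVec (Sum.elim r s) (Sum.elim x α) ∈ L := by rw [hz]; simpa using hw
  rw [hL, sub_unitVec_mem] at hzL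
  obtain ⟨hP1, hzap⟩ := hzL
  have hzc : ∀ o, |c o - z o| ≤ (N / 8 : ℕ) := by
    intro o
    have := hwc o
    rwa [Pi.sub_apply, sub_sub, add_comm] at this
  have hq0 := abs_le.1 (hzc none)
  have hsm : ∀ i, |z (some i)| ≤ (N / 8 : ℕ) := by
    intro i
    have := hzc (some i)
    rwa [show c (some i) = 0 from rfl, zero_sub, abs_neg] at this
  simp only [c, Option.elim] at hq0
  have hzN : ∀ o, |z o| ≤ (N : ℤ) := by
    intro o
    rcases o with _ | i
    · rw [abs_le]; omega
    · refine (hsm i).trans ?_; omega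
  have hres : res z ∈ boxPoints Λ (unitVec s α) N := by
    rw [mem_boxPoints, hΛ, sub_unitVec_mem]
    refine ⟨fun o => ?_, hP1, fun i => hzap (Sum.inr i)⟩
    rcases o with _ | i <;> exact hzN _
  have hndvd : ∀ l : ℕ, l.Prime → (l : ℤ) ∣ z none → ¬ l ∣ P := by
    intro l hl hlz hlP
    have h4 : (l : ℤ) ∣ z none - 1 := (Int.natCast_dvd_natCast.2 hlP).trans hP1
    have h5 : (l : ℤ) ∣ 1 := by simpa using dvd_sub hlz h4
    exact hl.one_lt.ne' (by exact_mod_cast Int.eq_one_of_dvd_one (by positivity) h5)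
  have hnind : ∀ l : ℕ, l.Prime → (l : ℤ) ∣ z none → ¬ l ∣ Λ.index := by
    intro l hl hlz hli
    rw [hΛ, index_approxLattice] at hli
    rcases hl.dvd_mul.1 hli with h6 | h6
    · exact hndvd l hl hlz h6
    · obtain ⟨i, -, hi⟩ := (Nat.prime_iff.1 hl).exists_mem_finset_dvd h6
      have := (Nat.prime_dvd_prime_iff_eq hl hp).1 (hl.dvd_of_dvd_pow hi)
      exact hndvd l hl hlz (this ▸ hpP)
  obtain ⟨q, hq⟩ : ∃ q : ℕ, z none = q := ⟨(z none).toNat, by omega⟩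
  refine ⟨q, by omega, by omega, fun hpq => ?_, fun j => ?_, fun i => ?_⟩
  · exact hndvd p hp (by rw [hq]; exact_mod_cast hpq) hpP
  · refine ⟨z (some (Sum.inl j)), (hsm _).trans (by omega), ?_, ?_⟩
    · by_contra hcop
      obtain ⟨l, hl, d0, d1⟩ := exists_prime_dvd_of_not_isCoprime hcop
      rw [← hq] at d0
      refine h3 (res z) hres j l hl (hnind l hl d0) d0 (hmem z N _ hzN hzap fun j' => ?_)
      by_cases hj : j' = j
      · subst hj; rwa [Function.update_self]
      · rw [Function.update_of_ne hj]; simp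
    · have := hzap (Sum.inl j)
      rw [hq] at this
      exact_mod_cast this
  · refine ⟨z (some (Sum.inr i)), (hsm _).trans (by omega), ?_, ?_⟩
    · by_contra hcop
      obtain ⟨l, hl, d0, d1⟩ := exists_prime_dvd_of_not_isCoprime hcop
      rw [← hq] at d0
      exact h2 (res z) hres i l hl (hnind l hl d0) d0 d1 (hmem z N _ hzN hzap fun _ => by simp)
    · have := hzap (Sum.inr i)
      rw [hq] at this
      exact_mod_cast this

/-- The denominators `q ≡ 1` modulo `P` are prime to `p`. -/
theorem not_dvd_of_mem_unit_coset {P : ℕ} (hpP : p ∣ P) {α : Fin m → ℤ_[p]} {s : Fin m → ℕ}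
    {z : Option (Fin m) → ℤ} {R : ℕ}
    (hz : z ∈ boxPoints (approxLattice P s α) (unitVec s α) R) : ¬ (p : ℤ) ∣ z none := by
  rw [mem_boxPoints, sub_unitVec_mem] at hz
  intro hpz
  have h1 : (p : ℤ) ∣ 1 := by
    simpa using dvd_sub hpz ((Int.natCast_dvd_natCast.2 hpP).trans hz.2.1)
  exact (Fact.out : p.Prime).one_lt.ne' (by exact_mod_cast Int.eq_one_of_dvd_one (by positivity) h1)

theorem card_boxPoints_le {P : ℕ} {α : Fin m → ℤ_[p]} {s : Fin m → ℕ} {ρ R S : ℕ} (hP : 0 < P)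
    (hc : Covers (approxLattice P s α) ρ) (u : Option (Fin m) → ℤ) (hRS : 2 * (R + ρ) + 1 ≤ S) :
    ((boxPoints (approxLattice P s α) u R).card : ℝ) ≤
      (S : ℝ) ^ (m + 1) / (P * ∏ i, (p : ℝ) ^ s i) := by
  have hp := prime_cast_pos (p := p)
  have hi : (approxLattice P s α).index ≠ 0 := by
    rw [index_approxLattice]
    exact (Nat.mul_pos hP (Finset.prod_pos fun i _ => pow_pos (Fact.out : p.Prime).pos _)).ne'
  have hP' : (0 : ℝ) < P := by exact_mod_cast hP
  rw [le_div_iff₀ (mul_pos hP' (Finset.prod_pos fun i _ => pow_pos hp _))]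
  have h1 := (hc.card_boxPoints_mul_index_le hi u R).trans (Nat.pow_le_pow_left hRS _)
  rw [index_approxLattice, Fintype.card_option, Fintype.card_fin] at h1
  exact_mod_cast h1

open Classical in
/-- The first-moment estimate: the three exceptional sets together cover at most half of the
ball. -/
theorem half_le_real_isApproximable {P : ℕ} (hpP : p ∣ P) (hP : 0 < P) {α : Fin m → ℤ_[p]}
    {s : Fin m → ℕ} {r : Fin d → ℕ} (x₀ : Fin d → ℤ_[p]) {t N h ρ X K y : ℕ}
    (hy : ∀ l : ℕ, l.Prime → l ≤ y → l ∣ P) (hN : 8 ≤ N) (hh : 0 < h)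
    (hhN : h ≤ N) (hs : ∀ i, N ≤ p ^ s i) (hr : ∀ j, N ≤ p ^ r j) (htN : p ^ t ≤ N)
    (hind : P * (∏ i, p ^ s i) * ∏ j, p ^ r j ≤ N / 8 * h ^ (d + m))
    (hc : Covers (approxLattice P s α) ρ) (hρh : 2 * ρ + 1 ≤ h)
    (hpart : ∀ z ∈ approxLattice P s α, z none ≠ 0 → (∀ o, |z o| ≤ h) →
      ∀ e : ℕ, ‖(z none : ℤ_[p])‖ = (p : ℝ) ^ (-e : ℤ) → p ^ (t + e) ≤ h)
    (hX : 1 ≤ X) (hXN : 2 * X * (2 * ρ + 1) ≤ N) (hK : 4 * N ^ 2 < 2 ^ K)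
    (hE1 : 4 * (3 * h : ℝ) ^ (d + m + 1) ≤ P * (∏ i, (p : ℝ) ^ s i) * ∏ j, (p : ℝ) ^ r j)
    (hE2 : 4 * (d + m) * (2 / (y + 1) + (1 + 2 * K) / X + K * p ^ t / N) *
      (6 * N : ℝ) ^ (d + m + 1) ≤ P * (∏ i, (p : ℝ) ^ s i) * ∏ j, (p : ℝ) ^ r j) :
    1 / 2 * ((p : ℝ) ^ t)⁻¹ ^ d ≤ (haar p d).real
      {x | x ∈ (Set.univ.pi fun j => Metric.closedBall (x₀ j) ((p : ℝ) ^ (-t : ℤ))) ∧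
        IsApproximable α s r N x} := by
  have hp := prime_cast_pos (p := p)
  have : IsProbabilityMeasure (haar p d) := ⟨haar_univ p d⟩
  have hP' : (0 : ℝ) < P := by exact_mod_cast hP
  have hNpos : (0 : ℝ) < N := by exact_mod_cast (by omega : 0 < N)
  have hXpos : (0 : ℝ) < X := by exact_mod_cast hX
  set Λ := approxLattice P s α with hΛ
  set u := unitVec s α with hu
  have hidx : Λ.index = P * ∏ i, p ^ s i := index_approxLattice P s α
  have hidx0 : Λ.index ≠ 0 := by
    rw [hidx]
    exact (Nat.mul_pos hP (Finset.prod_pos fun i _ => pow_pos (Fact.out : p.Prime).pos _)).ne'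
  have hyi : ∀ l : ℕ, l.Prime → l ≤ y → l ∣ Λ.index := fun l hl hly => by
    rw [hidx]; exact (hy l hl hly).mul_right _
  set I : ℝ := P * ∏ i, (p : ℝ) ^ s i with hI
  set G : ℝ := ∏ j, (p : ℝ) ^ r j with hG
  set β : ℝ := ((p : ℝ) ^ t)⁻¹ ^ d with hβ
  have hIpos : 0 < I := mul_pos hP' (Finset.prod_pos fun i _ => pow_pos hp _)
  have hGpos : 0 < G := Finset.prod_pos fun i _ => pow_pos hp _
  have hβpos : 0 < β := by positivity
  set E₁ := ⋃ z ∈ (boxPoints Λ 0 h).filter fun z => z none ≠ 0,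
    approxBox x₀ t r (z none) h fun _ => 1 with hE₁
  set F := (boxPoints Λ u N).filter fun z => ∃ i, ∃ l : ℕ, l.Prime ∧ ¬ l ∣ Λ.index ∧
    (l : ℤ) ∣ z none ∧ (l : ℤ) ∣ z (some i) with hF
  set E₂ := ⋃ z ∈ F, approxBox x₀ t r (z none) N fun _ => 1 with hE₂
  set E₃ := ⋃ j ∈ (Finset.univ : Finset (Fin d)), ⋃ z ∈ boxPoints Λ u N,
    ⋃ l ∈ (z none).natAbs.primeFactors.filter (fun l => ¬ l ∣ Λ.index),
      approxBox x₀ t r (z none) N (Function.update (fun _ => 1) j l) with hE₃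
  have b1 : (haar p d).real E₁ ≤ 1 / 4 * β := by
    have hcard := card_boxPoints_le hP hc 0 (by omega : 2 * (h + ρ) + 1 ≤ 3 * h)
    calc (haar p d).real E₁ ≤ ∑ z ∈ (boxPoints Λ 0 h).filter fun z => z none ≠ 0,
          (haar p d).real (approxBox x₀ t r (z none) h fun _ => 1) :=
          measureReal_biUnion_finset_le _ _
      _ ≤ ∑ z ∈ (boxPoints Λ 0 h).filter fun z => z none ≠ 0, (3 * h : ℝ) ^ d * β * G⁻¹ := by
          refine Finset.sum_le_sum fun z hz => ?_
          obtain ⟨hz1, hz2⟩ := Finset.mem_filter.1 hz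
          rw [mem_boxPoints, sub_zero] at hz1
          have hzp : (z none : ℤ_[p]) ≠ 0 := by exact_mod_cast hz2
          have he := PadicInt.norm_eq_zpow_neg_valuation hzp
          exact real_approxBox_le he (hpart z hz1.2 hz2 hz1.1 _ he) fun j => hhN.trans (hr j)
      _ ≤ ((3 * h : ℕ) : ℝ) ^ (m + 1) / I * ((3 * h : ℝ) ^ d * β * G⁻¹) := by
          rw [Finset.sum_const, nsmul_eq_mul]
          gcongr
          exact le_trans (by exact_mod_cast Finset.card_filter_le _ _) hcard
      _ = (4 * (3 * h : ℝ) ^ (d + m + 1)) / (I * G) * (1 / 4 * β) := by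
          push_cast
          rw [show d + m + 1 = (m + 1) + d by omega, pow_add _ (m + 1) d]
          field_simp
      _ ≤ 1 * (1 / 4 * β) := by
          gcongr
          exact (div_le_one (by positivity)).2 hE1
      _ = _ := one_mul _
  have hT := card_boxPoints_le hP hc u (by omega : 2 * (2 * N + ρ) + 1 ≤ 6 * N)
  set T := (boxPoints Λ u (2 * N)).card with hTdef
  set η : ℝ := 2 / (y + 1) + (1 + 2 * K) / X + K * p ^ t / N with hη
  have hηpos : 0 ≤ η := by positivity
  -- The measure of `c η T` boxes: their number times the measure of one, with `T` bounded by `hT`.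
  have hfin : ∀ c : ℝ, 0 ≤ c → c * η * T * ((3 * N : ℝ) ^ d * β * G⁻¹) ≤
      c * (η * (6 * N : ℝ) ^ (d + m + 1) / (I * G)) * β := by
    intro c hc0
    calc c * η * T * ((3 * N : ℝ) ^ d * β * G⁻¹)
        ≤ c * η * (((6 * N : ℕ) : ℝ) ^ (m + 1) / I) * ((6 * N : ℝ) ^ d * β * G⁻¹) := by
          gcongr; norm_num
      _ = _ := by
          push_cast
          rw [show d + m + 1 = (m + 1) + d by omega, pow_add _ (m + 1) d]
          field_simp
  have b2 : (haar p d).real E₂ ≤ m * (η * (6 * N : ℝ) ^ (d + m + 1) / (I * G)) * β := by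
    have hFcard : (F.card : ℝ) ≤ m * η * T := by
      have hFsub : F ⊆ (Finset.univ : Finset (Fin m)).biUnion fun i =>
          (boxPoints Λ u N).filter fun z => ∃ l : ℕ, l.Prime ∧ ¬ l ∣ Λ.index ∧
            (l : ℤ) ∣ z none ∧ (l : ℤ) ∣ z (some i) := by
        intro z hz
        obtain ⟨hz, i, hl⟩ := Finset.mem_filter.1 hz
        exact Finset.mem_biUnion.2 ⟨i, Finset.mem_univ i, Finset.mem_filter.2 ⟨hz, hl⟩⟩
      calc (F.card : ℝ) ≤ ∑ i : Fin m, (((boxPoints Λ u N).filter fun z =>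
            ∃ l : ℕ, l.Prime ∧ ¬ l ∣ Λ.index ∧ (l : ℤ) ∣ z none ∧ (l : ℤ) ∣ z (some i)).card : ℝ) := by
            exact_mod_cast (Finset.card_le_card hFsub).trans Finset.card_biUnion_le
        _ ≤ ∑ i : Fin m, (T : ℝ) * (2 / (y + 1) + (1 + 2 * K) / X) :=
            Finset.sum_le_sum fun i _ => hc.card_common_prime_le hidx0 hX (by simp) u hXN hK hyi
        _ ≤ ∑ i : Fin m, (T : ℝ) * η := by
            gcongr
            rw [hη]
            exact le_add_of_nonneg_right (by positivity)
        _ = _ := by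
            rw [Finset.sum_const, Finset.card_univ, Fintype.card_fin, nsmul_eq_mul]; ring
    calc (haar p d).real E₂ ≤ ∑ z ∈ F, (haar p d).real (approxBox x₀ t r (z none) N fun _ => 1) :=
          measureReal_biUnion_finset_le _ _
      _ ≤ ∑ z ∈ F, (3 * N : ℝ) ^ d * β * G⁻¹ := by
          refine Finset.sum_le_sum fun z hz => ?_
          exact real_approxBox_le (norm_eq_of_not_dvd
            (not_dvd_of_mem_unit_coset hpP (Finset.mem_filter.1 hz).1)) htN hr
      _ ≤ m * η * T * ((3 * N : ℝ) ^ d * β * G⁻¹) := by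
          rw [Finset.sum_const, nsmul_eq_mul]
          gcongr
      _ ≤ _ := hfin m (by positivity)
  have b3 : (haar p d).real E₃ ≤ d * (η * (6 * N : ℝ) ^ (d + m + 1) / (I * G)) * β := by
    have hsum : ∑ z ∈ boxPoints Λ u N,
        ∑ l ∈ (z none).natAbs.primeFactors.filter (fun l => ¬ l ∣ Λ.index),
          ((l : ℝ)⁻¹ + (p : ℝ) ^ t / N) ≤ η * T := by
      have hNK : N < 2 ^ K := by
        refine lt_of_le_of_lt ?_ hK
        have : N ≤ N ^ 2 := Nat.le_self_pow (by norm_num) N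
        omega
      have hTN : ((boxPoints Λ u N).card : ℝ) ≤ T := by
        exact_mod_cast card_boxPoints_mono u (by omega)
      have h1 := hc.sum_inv_primeFactors_le (R := N) (K := K) hX none u
        (le_trans (Nat.mul_le_mul_right _ (by omega)) hXN) hNK hyi
      have h2 : ∑ z ∈ boxPoints Λ u N,
          ∑ l ∈ (z none).natAbs.primeFactors.filter (fun l => ¬ l ∣ Λ.index),
            ((p : ℝ) ^ t / N) ≤ T * (K * ((p : ℝ) ^ t / N)) := by
        calc _ ≤ ∑ z ∈ boxPoints Λ u N, K * ((p : ℝ) ^ t / N) := by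
              refine Finset.sum_le_sum fun z hz => ?_
              rw [Finset.sum_const, nsmul_eq_mul]
              gcongr
              refine (Finset.card_filter_le _ _).trans
                (card_primeFactors_le_of_lt_two_pow (lt_of_le_of_lt ?_ hNK))
              have := (mem_boxPoints.1 hz).1 none
              rw [Int.abs_eq_natAbs] at this
              exact_mod_cast this
          _ ≤ _ := by
              rw [Finset.sum_const, nsmul_eq_mul]
              gcongr
      simp only [Finset.sum_add_distrib]
      calc _ ≤ T * (2 / (y + 1) + K / X) + T * (K * ((p : ℝ) ^ t / N)) := add_le_add h1 h2
        _ = (2 / (y + 1) + K / X + K * p ^ t / N) * T := by ring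
        _ ≤ η * T := by
            rw [hη]
            gcongr
            linarith [(Nat.cast_nonneg K : (0 : ℝ) ≤ K)]
    calc (haar p d).real E₃ ≤ ∑ j : Fin d, ∑ z ∈ boxPoints Λ u N,
          ∑ l ∈ (z none).natAbs.primeFactors.filter (fun l => ¬ l ∣ Λ.index),
            (haar p d).real (approxBox x₀ t r (z none) N (Function.update (fun _ => 1) j l)) := by
          refine (measureReal_biUnion_finset_le _ _).trans (Finset.sum_le_sum fun j _ => ?_)
          refine (measureReal_biUnion_finset_le _ _).trans (Finset.sum_le_sum fun z _ => ?_)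
          exact measureReal_biUnion_finset_le _ _
      _ ≤ ∑ j : Fin d, ∑ z ∈ boxPoints Λ u N,
          ∑ l ∈ (z none).natAbs.primeFactors.filter (fun l => ¬ l ∣ Λ.index),
            ((3 * N : ℝ) ^ d * β * G⁻¹) * ((l : ℝ)⁻¹ + (p : ℝ) ^ t / N) := by
          refine Finset.sum_le_sum fun j _ => Finset.sum_le_sum fun z hz =>
            Finset.sum_le_sum fun l hl => ?_
          obtain ⟨hl1, hl2⟩ := Finset.mem_filter.1 hl
          refine real_approxBox_update_le (not_dvd_of_mem_unit_coset hpP hz) htN hr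
            (Nat.prime_of_mem_primeFactors hl1) (fun hlp => hl2 ?_) j
          rw [hlp, hidx]
          exact hpP.mul_right _
      _ ≤ d * η * T * ((3 * N : ℝ) ^ d * β * G⁻¹) := by
          simp only [← Finset.mul_sum]
          rw [Finset.sum_const, Finset.card_univ, Fintype.card_fin, nsmul_eq_mul]
          calc (3 * N : ℝ) ^ d * β * G⁻¹ * (d * _)
              ≤ (3 * N : ℝ) ^ d * β * G⁻¹ * (d * (η * T)) := by gcongr
            _ = _ := by ring
      _ ≤ _ := hfin d (by positivity)
  have b23 : m * (η * (6 * N : ℝ) ^ (d + m + 1) / (I * G)) * β +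
      d * (η * (6 * N : ℝ) ^ (d + m + 1) / (I * G)) * β ≤ 1 / 4 * β := by
    have h1 : 4 * (d + m) * η * (6 * N : ℝ) ^ (d + m + 1) / (I * G) ≤ 1 :=
      (div_le_one (by positivity)).2 hE2
    calc _ = (4 * (d + m) * η * (6 * N : ℝ) ^ (d + m + 1) / (I * G)) * (1 / 4 * β) := by ring
      _ ≤ 1 * (1 / 4 * β) := by gcongr
      _ = _ := one_mul _
  set B := Set.univ.pi fun j => Metric.closedBall (x₀ j) ((p : ℝ) ^ (-t : ℤ)) with hB
  have hBmeas : (haar p d).real B = β := by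
    rw [hB, haar_real_pi, Finset.prod_congr rfl fun j _ => haar1_real_closedBall (x₀ j) t,
      Finset.prod_const, Finset.card_univ, Fintype.card_fin, zpow_neg, zpow_natCast]
  have hcover : B ⊆ (E₁ ∪ (E₂ ∪ E₃)) ∪ {x | x ∈ B ∧ IsApproximable α s r N x} := by
    intro x hx
    by_cases hxE : x ∈ E₁ ∪ (E₂ ∪ E₃)
    · exact Or.inl hxE
    refine Or.inr ⟨hx, ?_⟩
    simp only [Set.mem_union, not_or, hE₁, hE₂, hE₃, Set.mem_iUnion, not_exists] at hxE
    obtain ⟨n1, n2, n3⟩ := hxE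
    refine isApproximable_of_notMem hpP hP hN hh hhN hs hr hind hx
      (fun z hz hz0 => n1 z (Finset.mem_filter.2 ⟨hz, hz0⟩))
      (fun z hz i l hl hli d0 d1 => n2 z (Finset.mem_filter.2 ⟨hz, i, l, hl, hli, d0, d1⟩))
      fun z hz j l hl hli d0 => n3 j (Finset.mem_univ j) z hz l (Finset.mem_filter.2
        ⟨Nat.mem_primeFactors.2 ⟨hl, Int.natCast_dvd.1 d0, fun h0 => ?_⟩, hli⟩)
    refine not_dvd_of_mem_unit_coset hpP hz ?_
    rw [Int.natAbs_eq_zero.1 h0]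
    exact dvd_zero _
  have hfinal := (measureReal_mono (μ := haar p d) hcover (measure_ne_top _ _)).trans
    (measureReal_union_le _ _)
  have hE := (measureReal_union_le (μ := haar p d) E₁ (E₂ ∪ E₃)).trans
    (add_le_add le_rfl (measureReal_union_le E₂ E₃))
  rw [hBmeas] at hfinal
  linarith

end Exceptional

/-! ### Growth estimates -/

section Asymptotics

theorem eventually_mul_rpow_le (c : ℝ) {a b : ℝ} (hab : a < b) :
    ∀ᶠ N : ℕ in atTop, c * (N : ℝ) ^ a ≤ (N : ℝ) ^ b := by
  have h1 : ∀ᶠ N : ℕ in atTop, c ≤ (N : ℝ) ^ (b - a) :=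
    ((tendsto_rpow_atTop (sub_pos.2 hab)).comp tendsto_natCast_atTop_atTop).eventually_ge_atTop c
  filter_upwards [h1, eventually_gt_atTop 0] with N hN hN0
  have : (0 : ℝ) < N := by exact_mod_cast hN0
  calc c * (N : ℝ) ^ a ≤ (N : ℝ) ^ (b - a) * (N : ℝ) ^ a := by gcongr
    _ = _ := by rw [← Real.rpow_add this, sub_add_cancel]

theorem tendsto_floor_rpow_atTop {a : ℝ} (ha : 0 < a) :
    Tendsto (fun N : ℕ => ⌊(N : ℝ) ^ a⌋₊) atTop atTop :=
  tendsto_nat_floor_atTop.comp ((tendsto_rpow_atTop ha).comp tendsto_natCast_atTop_atTop)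

theorem eventually_mul_log_le (c : ℝ) {a : ℝ} (ha : 0 < a) :
    ∀ᶠ N : ℕ in atTop, c * ((2 * Nat.log 2 N + 4 : ℕ) : ℝ) ≤ (N : ℝ) ^ a := by
  have h1 : ∀ᶠ N : ℕ in atTop, ‖Real.log N‖ ≤ (8 * (|c| + 1))⁻¹ * ‖(N : ℝ) ^ a‖ :=
    tendsto_natCast_atTop_atTop.eventually
      ((isLittleO_log_rpow_atTop ha).def (c := (8 * (|c| + 1))⁻¹) (by positivity))
  have h2 := eventually_mul_rpow_le (8 * (|c| + 1)) ha
  filter_upwards [h1, h2, eventually_gt_atTop 0] with N hN1 hN2 hN0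
  have hNpos : (0 : ℝ) < N := by exact_mod_cast hN0
  have hN1' : (1 : ℝ) ≤ N := by exact_mod_cast hN0
  rw [Real.norm_of_nonneg (Real.log_nonneg hN1'),
    Real.norm_of_nonneg (by positivity : (0 : ℝ) ≤ (N : ℝ) ^ a), ← div_eq_inv_mul,
    le_div_iff₀ (by positivity)] at hN1
  rw [Real.rpow_zero, mul_one] at hN2
  have h3 : (Nat.log 2 N : ℝ) ≤ 2 * Real.log N := by
    have h4 : (2 : ℝ) ^ Nat.log 2 N ≤ N := by exact_mod_cast Nat.pow_log_le_self 2 (by omega)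
    have h5 := Real.log_le_log (by positivity) h4
    rw [Real.log_pow] at h5
    have h6 := Real.log_two_gt_d9
    have h7 : (Nat.log 2 N : ℝ) * (1 / 2) ≤ Nat.log 2 N * Real.log 2 := by gcongr; linarith
    linarith
  have h8 : 0 ≤ |c| := abs_nonneg c
  have h9 : 0 ≤ Real.log N := Real.log_nonneg hN1'
  calc c * ((2 * Nat.log 2 N + 4 : ℕ) : ℝ) ≤ (|c| + 1) * ((2 * Nat.log 2 N + 4 : ℕ) : ℝ) := by
        gcongr
        linarith [le_abs_self c]
    _ ≤ (|c| + 1) * (4 * Real.log N + 4) := by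
        push_cast
        exact mul_le_mul_of_nonneg_left (by linarith) (by positivity)
    _ ≤ _ := by nlinarith

theorem four_mul_sq_lt_two_pow (N : ℕ) : 4 * N ^ 2 < 2 ^ (2 * Nat.log 2 N + 4) := by
  have h := Nat.lt_pow_succ_log_self (b := 2) (by norm_num) N
  calc 4 * N ^ 2 < 4 * (2 ^ (Nat.log 2 N).succ) ^ 2 := by gcongr
    _ = _ := by
      rw [← pow_mul, show (4 : ℕ) = 2 ^ 2 by norm_num, ← pow_add]
      congr 1
      omega

theorem zpow_neg_lt_rpow {p N : ℕ} (hN : 0 < N) {s : ℕ} {a : ℝ} (h : (N : ℝ) ^ a < (p : ℝ) ^ s) :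
    (p : ℝ) ^ (-s : ℤ) < (N : ℝ) ^ (-a) := by
  have hN' : (0 : ℝ) < N := by exact_mod_cast hN
  rw [zpow_neg, zpow_natCast, Real.rpow_neg hN'.le]
  exact inv_strictAnti₀ (by positivity) h

theorem lt_pow_of_rpow_lt {p N : ℕ} {s : ℕ} {a : ℝ} (ha : 1 < a) (hN : 0 < N)
    (h : (N : ℝ) ^ a < (p : ℝ) ^ s) : N < p ^ s := by
  have hN' : (1 : ℝ) ≤ N := by exact_mod_cast hN
  have := Real.self_le_rpow_of_one_le hN' ha.le
  exact_mod_cast this.trans_lt h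

end Asymptotics

/-! ### Consequences of the Diophantine exponent -/

section Diophantine

variable {p : ℕ} [Fact p.Prime] {m : ℕ}

/-- Weights of sum larger than the Diophantine exponent are attained by no approximation of large
height; denominators of either sign are allowed. -/
theorem eventually_le_norm_of_diophantineExponent_le {α : Fin m → ℤ_[p]}
    (hα : diophantineExponent α ≤ ((m + 1 : ℝ) : EReal)) {σ : Fin m → ℝ} (hσ : ∀ i, 0 < σ i)
    (hsum : (m : ℝ) + 1 < ∑ i, σ i) :
    ∀ᶠ Q : ℕ in atTop, ∀ (q₀ : ℤ) (q : Fin m → ℤ), q₀ ≠ 0 → |q₀| ≤ Q → (∀ i, |q i| ≤ Q) →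
      ∃ i, (Q : ℝ) ^ (-σ i) ≤ ‖(q₀ : ℤ_[p]) * α i - q i‖ := by
  by_contra hcon
  rw [not_eventually] at hcon
  have hle : ((∑ i, σ i : ℝ) : EReal) ≤ diophantineExponent α := by
    refine le_sSup ⟨σ, hσ, hcon.mono fun Q hQ => ?_, rfl⟩
    push Not at hQ
    obtain ⟨q₀, q, h0, hq0, hq, hlt⟩ := hQ
    rcases lt_or_gt_of_ne h0 with hneg | hpos
    · refine ⟨q₀.natAbs, fun i => -q i, Int.natAbs_pos.2 h0, ?_, fun i => by
        rw [abs_neg]; exact hq i, fun i => ?_⟩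
      · rw [Int.abs_eq_natAbs] at hq0; exact_mod_cast hq0
      · have h1 : ((q₀.natAbs : ℕ) : ℤ_[p]) = -(q₀ : ℤ_[p]) := by
          rw [← Int.cast_natCast, Int.ofNat_natAbs_of_nonpos hneg.le, Int.cast_neg]
        rw [h1, show -(q₀ : ℤ_[p]) * α i - ((-q i : ℤ) : ℤ_[p]) = -(q₀ * α i - q i) by
          push_cast; ring, norm_neg]
        exact hlt i
    · refine ⟨q₀.natAbs, q, Int.natAbs_pos.2 h0, ?_, hq, fun i => ?_⟩
      · rw [Int.abs_eq_natAbs] at hq0; exact_mod_cast hq0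
      · have h1 : ((q₀.natAbs : ℕ) : ℤ_[p]) = (q₀ : ℤ_[p]) := by
          rw [← Int.cast_natCast, Int.natAbs_of_nonneg hpos.le]
        rw [h1]
        exact hlt i
  have := hle.trans hα
  rw [EReal.coe_le_coe_iff] at this
  linarith

/-- If `α` has Diophantine exponent at most `m + 1`, its approximation lattices at height `N` have
no nonzero vector of norm at most `N ^ θ`, for every `θ` below the exponent expected from the
covolume. -/
theorem eventually_lt_abs_of_mem_approxLattice {α : Fin m → ℤ_[p]}
    (hα : diophantineExponent α ≤ ((m + 1 : ℝ) : EReal)) {τ : Fin m → ℝ} (hτ : ∀ i, 1 < τ i)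
    {θ : ℝ} (hθ0 : 0 < θ) (hθ1 : θ ≤ 1) (hθ : ((m : ℝ) + 1) * θ < ∑ i, τ i) :
    ∀ᶠ N : ℕ in atTop, ∀ (P : ℕ) (s : Fin m → ℕ), (∀ i, (N : ℝ) ^ τ i < (p : ℝ) ^ s i) →
      ∀ z ∈ approxLattice P s α, z ≠ 0 → ∃ o, ((⌊(N : ℝ) ^ θ⌋₊ + 1 : ℕ) : ℤ) ≤ |z o| := by
  have hdio := (tendsto_floor_rpow_atTop hθ0).eventually
    (eventually_le_norm_of_diophantineExponent_le hα (σ := fun i => τ i / θ)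
      (fun i => div_pos (by linarith [hτ i]) hθ0)
      (by rw [← Finset.sum_div, lt_div_iff₀ hθ0]; exact hθ))
  filter_upwards [hdio, eventually_gt_atTop 0,
    (tendsto_floor_rpow_atTop hθ0).eventually_gt_atTop 0] with N hN hN0 hQ0 P s hs z hz hz0
  have hN1 : (1 : ℝ) ≤ N := by exact_mod_cast hN0
  by_contra! hlt
  have hle : ∀ o, |z o| ≤ (⌊(N : ℝ) ^ θ⌋₊ : ℤ) := fun o => by have := hlt o; push_cast at this; omega
  have hfl : (⌊(N : ℝ) ^ θ⌋₊ : ℝ) ≤ (N : ℝ) ^ θ := Nat.floor_le (by positivity)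
  have hQN : ⌊(N : ℝ) ^ θ⌋₊ ≤ N := by
    have : (N : ℝ) ^ θ ≤ (N : ℝ) ^ (1 : ℝ) := Real.rpow_le_rpow_of_exponent_le hN1 hθ1
    rw [Real.rpow_one] at this
    exact_mod_cast hfl.trans this
  rw [mem_approxLattice] at hz
  have hne : z none ≠ 0 := by
    intro h0
    refine hz0 (funext fun o => ?_)
    rcases o with _ | i
    · exact h0
    have := hz.2 i
    rw [h0, Int.cast_zero, zero_mul, zero_sub, norm_neg] at this
    exact eq_zero_of_norm_le this (hlt _)
      (by have := lt_pow_of_rpow_lt (hτ i) hN0 (hs i); omega)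
  obtain ⟨i, hi⟩ := hN (z none) (fun i => z (some i)) hne (hle _) fun i => hle _
  refine absurd (hi.trans (hz.2 i)) (not_le.2 ((zpow_neg_lt_rpow hN0 (hs i)).trans_le ?_))
  have hQpos : (0 : ℝ) < (⌊(N : ℝ) ^ θ⌋₊ : ℝ) := by exact_mod_cast hQ0
  calc (N : ℝ) ^ (-τ i) = ((N : ℝ) ^ θ) ^ (-(τ i / θ)) := by
        rw [← Real.rpow_mul (by positivity)]
        congr 1
        field_simp
    _ ≤ _ := Real.rpow_le_rpow_of_nonpos hQpos hfl
        (neg_nonpos.2 (div_nonneg (by linarith [hτ i]) hθ0.le))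

/-- The approximation lattices of `α` at height `N` have covering radius at most `N ^ γ` for some
`γ < 1`: their index is about `N ^ (∑ τ)` with `∑ τ < m + 1`, and their nonzero vectors are almost as
long as the index predicts. -/
theorem exists_eventually_covers {α : Fin m → ℤ_[p]}
    (hα : diophantineExponent α ≤ ((m + 1 : ℝ) : EReal)) (hm : 1 ≤ m) {τ : Fin m → ℝ}
    (hτ : ∀ i, 1 < τ i) (hsum : ∑ i, τ i < (m : ℝ) + 1) :
    ∃ γ : ℝ, 0 < γ ∧ γ < 1 ∧ ∀ P : ℕ, 0 < P → ∀ᶠ N : ℕ in atTop, ∀ s : Fin m → ℕ,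
      (∀ i, (N : ℝ) ^ τ i < (p : ℝ) ^ s i ∧ (p : ℝ) ^ s i ≤ p * (N : ℝ) ^ τ i) →
      Covers (approxLattice P s α) ⌊(N : ℝ) ^ γ⌋₊ := by
  have hp := prime_cast_pos (p := p)
  set S := ∑ i, τ i with hS
  have hm' : (1 : ℝ) ≤ m := by exact_mod_cast hm
  have hSm : (m : ℝ) ≤ S := by
    calc (m : ℝ) = ∑ _i : Fin m, (1 : ℝ) := by simp
      _ ≤ S := Finset.sum_le_sum fun i _ => (hτ i).le
  set ϑ := S / (m + 1) with hϑ
  have hϑ1 : ϑ < 1 := (div_lt_one (by positivity)).2 hsum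
  have hϑS : (m + 1) * ϑ = S := by rw [hϑ]; field_simp
  have hϑ2 : 1 / 2 ≤ ϑ := by rw [hϑ, div_le_div_iff₀ (by norm_num) (by positivity)]; linarith
  set ε := (1 - ϑ) / (2 * (m + 1)) with hε
  have hεm : (m + 1) * ε = (1 - ϑ) / 2 := by rw [hε]; field_simp
  have hε0 : 0 < ε := div_pos (by linarith) (by positivity)
  have hε1 : ε ≤ 1 / 4 := by nlinarith
  refine ⟨(1 + ϑ) / 2, by linarith, by linarith, fun P hP => ?_⟩
  have hlow := eventually_lt_abs_of_mem_approxLattice hα hτ (θ := ϑ - ε) (by linarith)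
    (by linarith) (by nlinarith)
  have hexp : S < (1 + ϑ) / 2 + (ϑ - ε) * m := by nlinarith
  filter_upwards [hlow, eventually_gt_atTop 0,
    eventually_mul_rpow_le (2 * (P * (p : ℝ) ^ m)) hexp,
    eventually_mul_rpow_le 1 (show (0 : ℝ) < (1 + ϑ) / 2 by linarith)] with N hN hN0 hNexp hN1 s hs
  have hNpos : (0 : ℝ) < N := by exact_mod_cast hN0
  rw [Real.rpow_zero, mul_one] at hN1
  set h := ⌊(N : ℝ) ^ (ϑ - ε)⌋₊ + 1 with hh
  set ρ := ⌊(N : ℝ) ^ ((1 + ϑ) / 2)⌋₊ with hρ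
  have hidx : (approxLattice P s α).index = P * ∏ i, p ^ s i := index_approxLattice P s α
  refine covers_of_forall_le_abs _ ?_ (Nat.succ_pos _)
    (fun z hz hz0 => hN P s (fun i => (hs i).1) z hz hz0) ?_
  · rw [hidx]
    exact (Nat.mul_pos hP (Finset.prod_pos fun i _ => pow_pos (Fact.out : p.Prime).pos _)).ne'
  rw [Fintype.card_option, Fintype.card_fin, pow_succ, ← mul_assoc]
  refine Nat.mul_le_mul_right _ ?_
  have hρ2 : (N : ℝ) ^ ((1 + ϑ) / 2) ≤ 2 * ρ := by
    have h1 := Nat.lt_floor_add_one ((N : ℝ) ^ ((1 + ϑ) / 2))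
    have h2 : 1 ≤ ρ := Nat.le_floor (by simpa using hN1)
    have h3 : (1 : ℝ) ≤ ρ := by exact_mod_cast h2
    linarith
  have hh2 : (N : ℝ) ^ (ϑ - ε) ≤ h := by
    rw [hh]; push_cast; exact (Nat.lt_floor_add_one _).le
  have hprod : ((approxLattice P s α).index : ℝ) ≤ P * ((p : ℝ) ^ m * (N : ℝ) ^ S) := by
    rw [hidx]
    push_cast
    gcongr
    calc ∏ i, (p : ℝ) ^ s i ≤ ∏ i, (p * (N : ℝ) ^ τ i) :=
          Finset.prod_le_prod (fun i _ => by positivity) fun i _ => (hs i).2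
      _ = _ := by
          rw [Finset.prod_mul_distrib, Finset.prod_const, Finset.card_univ, Fintype.card_fin,
            ← Real.rpow_sum_of_pos hNpos]
  have hfinal : ((approxLattice P s α).index : ℝ) ≤ ρ * (h : ℝ) ^ m := by
    have h4 : (N : ℝ) ^ ((1 + ϑ) / 2 + (ϑ - ε) * m) ≤ 2 * ρ * (h : ℝ) ^ m := by
      rw [Real.rpow_add hNpos, Real.rpow_mul hNpos.le, Real.rpow_natCast]
      gcongr
    nlinarith
  exact_mod_cast hfinal

/-- The `p`-part of the denominator of an approximation to `α` at height `N` is at most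
`N ^ (1 - δ)`: otherwise dividing by it gives too good an approximation of height `N ^ δ`. -/
theorem exists_eventually_pPart_le {α : Fin m → ℤ_[p]}
    (hα : diophantineExponent α ≤ ((m + 1 : ℝ) : EReal)) (hm : 1 ≤ m) {τ : Fin m → ℝ}
    (hτ : ∀ i, 1 < τ i) (hsum : ∑ i, τ i < (m : ℝ) + 1) :
    ∃ δ : ℝ, 0 < δ ∧ δ < 1 ∧ ∀ᶠ N : ℕ in atTop, ∀ (P : ℕ) (s : Fin m → ℕ),
      (∀ i, (N : ℝ) ^ τ i < (p : ℝ) ^ s i) →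
      ∀ z ∈ approxLattice P s α, z none ≠ 0 → (∀ o, |z o| ≤ N) → ∀ e : ℕ,
        ‖(z none : ℤ_[p])‖ = (p : ℝ) ^ (-e : ℤ) → (p : ℝ) ^ e ≤ (N : ℝ) ^ (1 - δ) := by
  have hp := prime_cast_pos (p := p)
  have hpp : p.Prime := Fact.out
  set S := ∑ i, (τ i - 1) with hS
  have hS1 : S < 1 := by
    rw [hS, Finset.sum_sub_distrib]
    simp only [Finset.sum_const, Finset.card_univ, Fintype.card_fin, nsmul_eq_mul, mul_one]
    linarith
  have hS0 : 0 < S := by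
    refine Finset.sum_pos (fun i _ => by linarith [hτ i]) ⟨⟨0, hm⟩, Finset.mem_univ _⟩
  have hm' : (1 : ℝ) ≤ m := by exact_mod_cast hm
  set δ := S / (2 * (m + 1)) with hδ
  have hδ0 : 0 < δ := by positivity
  have hδm : (m + 1) * δ = S / 2 := by rw [hδ]; field_simp
  have hδ1 : δ < 1 := by nlinarith
  refine ⟨δ, hδ0, hδ1, ?_⟩
  have hdio := (tendsto_floor_rpow_atTop hδ0).eventually
    (eventually_le_norm_of_diophantineExponent_le hα (σ := fun i => (τ i - 1) / δ)
      (fun i => div_pos (by linarith [hτ i]) hδ0)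
      (by rw [← Finset.sum_div, lt_div_iff₀ hδ0]; linarith))
  filter_upwards [hdio, eventually_gt_atTop 0,
    (tendsto_floor_rpow_atTop hδ0).eventually_gt_atTop 0] with N hN hN0 hQ0 P s hs z hz hz0 hzN e he
  by_contra! hlt
  -- Write `(q, b) = p ^ e (q', b')`, so that `(q', b')` has height at most `N ^ δ`; the loss of `p ^ e`
  -- in the precision is at most `N`, since `p ^ e` divides `q`.
  have hNpos : (0 : ℝ) < N := by exact_mod_cast hN0
  have hfl : (⌊(N : ℝ) ^ δ⌋₊ : ℝ) ≤ (N : ℝ) ^ δ := Nat.floor_le (by positivity)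
  rw [mem_approxLattice] at hz
  have hpe : ((p ^ e : ℕ) : ℤ) ∣ z none := by
    rw [Nat.cast_pow, ← PadicInt.norm_int_le_pow_iff_dvd (p := p)]; exact he.le
  have hpeN : p ^ e ≤ N := by
    have h1 := Int.le_of_dvd (abs_pos.2 hz0) ((dvd_abs _ _).2 hpe)
    exact_mod_cast h1.trans (hzN none)
  have hes : ∀ i, e ≤ s i := fun i => by
    have := hpeN.trans_lt (lt_pow_of_rpow_lt (hτ i) hN0 (hs i))
    exact ((Nat.pow_lt_pow_iff_right hpp.one_lt).1 this).le
  have hpe' : ∀ i, ((p ^ e : ℕ) : ℤ) ∣ z (some i) := by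
    intro i
    rw [Nat.cast_pow, ← PadicInt.norm_int_le_pow_iff_dvd (p := p)]
    have h1 : (z (some i) : ℤ_[p]) = z none * α i - (z none * α i - z (some i)) := by ring
    rw [h1]
    refine (norm_sub_le_max_padicInt _ _).trans (max_le ?_ ((hz.2 i).trans ?_))
    · rw [norm_mul, he]
      exact mul_le_of_le_one_right (by positivity) (PadicInt.norm_le_one _)
    · exact zpow_le_zpow_right₀ (by exact_mod_cast hpp.one_lt.le) (by have := hes i; omega)
  obtain ⟨q, hq⟩ := hpe
  choose b hb using hpe'
  have hsmall : ∀ a c : ℤ, a = ((p ^ e : ℕ) : ℤ) * c → |a| ≤ N → |c| ≤ (⌊(N : ℝ) ^ δ⌋₊ : ℤ) := by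
    intro a c hac haN
    rw [Int.abs_eq_natAbs]
    refine Int.ofNat_le.2 (Nat.le_floor ?_)
    have h1 : (p : ℝ) ^ e * (c.natAbs : ℝ) ≤ N := by
      rw [hac, abs_mul, Nat.abs_cast, Int.abs_eq_natAbs] at haN
      exact_mod_cast haN
    have h2 : (N : ℝ) = (N : ℝ) ^ (1 - δ) * (N : ℝ) ^ δ := by
      rw [← Real.rpow_add hNpos, sub_add_cancel, Real.rpow_one]
    by_contra! h3
    have h4 : (N : ℝ) ^ (1 - δ) * (N : ℝ) ^ δ < (p : ℝ) ^ e * (c.natAbs : ℝ) :=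
      mul_lt_mul'' hlt h3 (by positivity) (by positivity)
    linarith
  have hq0 : q ≠ 0 := fun h => hz0 (by rw [hq, h, mul_zero])
  obtain ⟨i, hi⟩ := hN q b hq0 (hsmall _ _ hq (hzN _)) fun i => hsmall _ _ (hb i) (hzN _)
  have h5 : (p : ℝ) ^ (-e : ℤ) * ‖(q : ℤ_[p]) * α i - b i‖ < (N : ℝ) ^ (-τ i) := by
    have h6 := (hz.2 i).trans_lt (zpow_neg_lt_rpow hN0 (hs i))
    have h7 : (z none : ℤ_[p]) * α i - z (some i) = (p : ℤ_[p]) ^ e * (q * α i - b i) := by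
      rw [hq, hb i]; push_cast; ring
    rwa [h7, norm_mul, PadicInt.norm_p_pow] at h6
  have hQpos : (0 : ℝ) < (⌊(N : ℝ) ^ δ⌋₊ : ℝ) := by exact_mod_cast hQ0
  have h8 : (N : ℝ) ^ (-(τ i - 1)) ≤ ‖(q : ℤ_[p]) * α i - b i‖ := by
    refine le_trans ?_ hi
    calc (N : ℝ) ^ (-(τ i - 1)) = ((N : ℝ) ^ δ) ^ (-((τ i - 1) / δ)) := by
          rw [← Real.rpow_mul hNpos.le]
          congr 1
          field_simp
      _ ≤ _ := Real.rpow_le_rpow_of_nonpos hQpos hfl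
          (neg_nonpos.2 (div_nonneg (by linarith [hτ i]) hδ0.le))
  have h9 : (N : ℝ)⁻¹ ≤ (p : ℝ) ^ (-e : ℤ) := by
    rw [zpow_neg, zpow_natCast]
    exact inv_anti₀ (by positivity) (by exact_mod_cast hpeN)
  have h10 : (N : ℝ) ^ (-τ i) = (N : ℝ)⁻¹ * (N : ℝ) ^ (-(τ i - 1)) := by
    rw [← Real.rpow_neg_one, ← Real.rpow_add hNpos]
    congr 1
    ring
  have h11 : (N : ℝ)⁻¹ * (N : ℝ) ^ (-(τ i - 1)) ≤
      (p : ℝ) ^ (-e : ℤ) * ‖(q : ℤ_[p]) * α i - b i‖ := by gcongr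
  linarith

end Diophantine

/-! ### Choice of the parameters -/

section Assembly

variable {p : ℕ} [Fact p.Prime] {d m : ℕ}

theorem exists_pow_gt_le {x : ℝ} (hx : 1 ≤ x) :
    ∃ s : ℕ, x < (p : ℝ) ^ s ∧ (p : ℝ) ^ s ≤ p * x := by
  obtain ⟨n, h1, h2⟩ := exists_nat_pow_near hx
    (show (1 : ℝ) < p by exact_mod_cast (Fact.out : p.Prime).one_lt)
  refine ⟨n + 1, h2, ?_⟩
  rw [pow_succ, mul_comm]
  gcongr

theorem exists_max_mul_pow_le {A W n : ℕ} (hA : 0 < A) (hn : n ≠ 0) :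
    ∃ h : ℕ, A * h ^ n ≤ W ∧ W < A * (h + 1) ^ n := by
  classical
  have hex : ∃ h, W < A * (h + 1) ^ n := by
    refine ⟨W, ?_⟩
    calc W < W + 1 := Nat.lt_succ_self W
      _ ≤ (W + 1) ^ n := Nat.le_self_pow hn _
      _ ≤ _ := Nat.le_mul_of_pos_left _ hA
  refine ⟨Nat.find hex, ?_, Nat.find_spec hex⟩
  rcases hf : Nat.find hex with _ | k
  · simp [hn]
  · exact not_lt.1 (Nat.find_min hex (m := k) (by omega))

/-- The choice of `κ`: a power of `p ^ d` at least `C` and at most `p ^ d C`. -/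
theorem exists_pow_near_mul {C d : ℕ} (hd : 1 ≤ d) (hC : 0 < C) :
    ∃ κ : ℕ, C ≤ p ^ (κ * d) ∧ p ^ (κ * d) ≤ p ^ d * C := by
  classical
  have hp : p.Prime := Fact.out
  have hex : ∃ κ, C ≤ p ^ (κ * d) := by
    refine ⟨C, (Nat.lt_pow_self hp.one_lt).le.trans ?_⟩
    exact Nat.pow_le_pow_right hp.pos (Nat.le_mul_of_pos_right _ hd)
  refine ⟨Nat.find hex, Nat.find_spec hex, ?_⟩
  rcases hf : Nat.find hex with _ | k
  · rw [zero_mul, pow_zero]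
    exact Nat.mul_pos (pow_pos hp.pos _) hC
  · have := not_le.1 (Nat.find_min hex (m := k) (by omega))
    rw [add_mul, one_mul, add_comm, pow_add]
    exact Nat.mul_le_mul_left _ this.le

theorem prod_rpow_bounds {p : ℕ} {ι : Type*} [Fintype ι] {N : ℕ} (hN : 0 < N) {a : ι → ℝ} {s : ι → ℕ}
    (h : ∀ i, (N : ℝ) ^ a i < (p : ℝ) ^ s i ∧ (p : ℝ) ^ s i ≤ p * (N : ℝ) ^ a i) :
    (N : ℝ) ^ ∑ i, a i ≤ ∏ i, (p : ℝ) ^ s i ∧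
      ∏ i, (p : ℝ) ^ s i ≤ (p : ℝ) ^ Fintype.card ι * (N : ℝ) ^ ∑ i, a i := by
  have hNpos : (0 : ℝ) < N := by exact_mod_cast hN
  rw [Real.rpow_sum_of_pos hNpos]
  constructor
  · exact Finset.prod_le_prod (fun i _ => by positivity) fun i _ => (h i).1.le
  · calc ∏ i, (p : ℝ) ^ s i ≤ ∏ i, (p * (N : ℝ) ^ a i) :=
          Finset.prod_le_prod (fun i _ => by positivity) fun i _ => (h i).2
      _ = _ := by rw [Finset.prod_mul_distrib, Finset.prod_const, Finset.card_univ]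

/-- The index of the lattice of approximations to `(x, α)` of precision `r - κ` and `s`, compared
with `N ^ (d + m + 1)`. -/
theorem index_bounds {N P B κ : ℕ} (hN : 0 < N) (hP : 0 < P) {τ : Fin m → ℝ} {v : Fin d → ℝ}
    {s : Fin m → ℕ} {r : Fin d → ℕ}
    (hs : ∀ i, (N : ℝ) ^ τ i < (p : ℝ) ^ s i ∧ (p : ℝ) ^ s i ≤ p * (N : ℝ) ^ τ i)
    (hr : ∀ j, (N : ℝ) ^ v j < (p : ℝ) ^ r j ∧ (p : ℝ) ^ r j ≤ p * (N : ℝ) ^ v j)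
    (hvτ : ∑ j, v j + ∑ i, τ i = ((d + m + 1 : ℕ) : ℝ)) (hκr : ∀ j, κ ≤ r j)
    (hκ1 : P * (p ^ (d + m) * B) ≤ p ^ (κ * d))
    (hκ2 : p ^ (κ * d) ≤ p ^ d * (P * (p ^ (d + m) * B))) :
    P * (∏ i, p ^ s i) * (∏ j, p ^ (r j - κ)) * B ≤ N ^ (d + m + 1) ∧
      N ^ (d + m + 1) ≤ p ^ d * (p ^ (d + m) * B) * (P * (∏ i, p ^ s i) * ∏ j, p ^ (r j - κ)) := by
  have hp := prime_cast_pos (p := p)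
  have hNpos : (0 : ℝ) < N := by exact_mod_cast hN
  have hPpos : (0 : ℝ) < P := by exact_mod_cast hP
  have hsplit : ∀ j, (p : ℝ) ^ r j = (p : ℝ) ^ κ * (p : ℝ) ^ (r j - κ) := fun j => by
    rw [← pow_add, Nat.add_sub_of_le (hκr j)]
  set W : ℕ := P * (∏ i, p ^ s i) * ∏ j, p ^ (r j - κ) with hW
  have hWκ : (p : ℝ) ^ (κ * d) * W = P * ((∏ i, (p : ℝ) ^ s i) * ∏ j, (p : ℝ) ^ r j) := by
    rw [hW, Finset.prod_congr rfl fun j _ => hsplit j, Finset.prod_mul_distrib, Finset.prod_const,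
      Finset.card_univ, Fintype.card_fin, pow_mul]
    push_cast
    ring
  clear_value W
  obtain ⟨ls, us⟩ := prod_rpow_bounds hN hs
  obtain ⟨lr, ur⟩ := prod_rpow_bounds hN hr
  rw [Fintype.card_fin] at us ur
  have hNn : (N : ℝ) ^ (d + m + 1) = (N : ℝ) ^ (∑ i, τ i) * (N : ℝ) ^ (∑ j, v j) := by
    rw [← Real.rpow_add hNpos, add_comm (∑ i, τ i), hvτ, Real.rpow_natCast]
  have hlow : P * (N : ℝ) ^ (d + m + 1) ≤ (p : ℝ) ^ (κ * d) * W := by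
    rw [hWκ, hNn]; gcongr
  have hup : (p : ℝ) ^ (κ * d) * W ≤ P * ((p : ℝ) ^ (d + m) * (N : ℝ) ^ (d + m + 1)) := by
    calc (p : ℝ) ^ (κ * d) * W ≤ P * (((p : ℝ) ^ m * (N : ℝ) ^ (∑ i, τ i)) *
          ((p : ℝ) ^ d * (N : ℝ) ^ (∑ j, v j))) := by rw [hWκ]; gcongr
      _ = _ := by rw [hNn, pow_add]; ring
  constructor
  · have h2 : (P * (p ^ (d + m) * B) : ℝ) ≤ (p : ℝ) ^ (κ * d) := by exact_mod_cast hκ1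
    have h3 : (P * (p : ℝ) ^ (d + m)) * (W * B) ≤ (P * (p : ℝ) ^ (d + m)) * (N : ℝ) ^ (d + m + 1) := by
      calc (P * (p : ℝ) ^ (d + m)) * (W * B) = (P * (p ^ (d + m) * B)) * W := by ring
        _ ≤ (p : ℝ) ^ (κ * d) * W := by gcongr
        _ ≤ _ := hup
        _ = _ := by ring
    exact_mod_cast le_of_mul_le_mul_left h3 (by positivity)
  · have h2 : (p : ℝ) ^ (κ * d) ≤ p ^ d * (P * (p ^ (d + m) * B)) := by exact_mod_cast hκ2
    have h3 : P * (N : ℝ) ^ (d + m + 1) ≤ P * (p ^ d * (p ^ (d + m) * B) * W) := by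
      calc P * (N : ℝ) ^ (d + m + 1) ≤ (p : ℝ) ^ (κ * d) * W := hlow
        _ ≤ (p ^ d * (P * (p ^ (d + m) * B))) * W := by gcongr
        _ = _ := by ring
    exact_mod_cast le_of_mul_le_mul_left h3 hPpos

/-- The scale `h` below which short lattice vectors are excluded: small against the index `W`, and
large enough for the resulting covering radius to be at most `N / 8`. -/
theorem exists_scale {A B W N n : ℕ} (hA : 0 < A) (hB : 0 < B)
    (hup : W * (8 * (A * 2 ^ (n + 1))) ^ (n + 1) ≤ N ^ (n + 1)) (hlow : N ^ (n + 1) ≤ B * W)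
    (hN : 2 * (A * B) ≤ N) :
    ∃ h : ℕ, 0 < h ∧ h ≤ N ∧ A * h ^ (n + 1) ≤ W ∧ W ≤ N / 8 * h ^ n ∧ N ≤ 2 * (A * B) * h := by
  obtain ⟨h, hh1, hh2⟩ := exists_max_mul_pow_le (W := W) hA (Nat.succ_ne_zero n)
  have hAB : 0 < A * B := Nat.mul_pos hA hB
  set D := 8 * (A * 2 ^ (n + 1)) with hD
  have hDpos : 0 < D := by positivity
  have hDh : D * h ≤ N := by
    refine (Nat.pow_le_pow_iff_left (Nat.succ_ne_zero n)).1 ?_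
    calc (D * h) ^ (n + 1) = D ^ (n + 1) * h ^ (n + 1) := mul_pow _ _ _
      _ ≤ D ^ (n + 1) * (A * h ^ (n + 1)) := by gcongr; exact Nat.le_mul_of_pos_left _ hA
      _ ≤ D ^ (n + 1) * W := by gcongr
      _ ≤ _ := by rw [mul_comm]; exact hup
  have hNh : N < A * B * (h + 1) := by
    refine lt_of_pow_lt_pow_left₀ (n + 1) (Nat.zero_le _) ?_
    calc N ^ (n + 1) ≤ B * W := hlow
      _ < B * (A * (h + 1) ^ (n + 1)) := Nat.mul_lt_mul_of_pos_left hh2 hB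
      _ = (A * B) * (h + 1) ^ (n + 1) := by ring
      _ ≤ (A * B) ^ (n + 1) * (h + 1) ^ (n + 1) := by
          gcongr; exact Nat.le_self_pow (Nat.succ_ne_zero n) _
      _ = _ := (mul_pow _ _ _).symm
  have hh : 0 < h := by
    by_contra h0
    have : h = 0 := by omega
    subst this
    omega
  refine ⟨h, hh, le_trans (Nat.le_mul_of_pos_left _ hDpos) hDh, hh1, ?_, ?_⟩
  · have h2 : A * 2 ^ (n + 1) * h ≤ N / 8 := by
      rw [Nat.le_div_iff_mul_le (by norm_num)]
      calc A * 2 ^ (n + 1) * h * 8 = D * h := by rw [hD]; ring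
        _ ≤ N := hDh
    calc W ≤ A * (h + 1) ^ (n + 1) := hh2.le
      _ ≤ A * (2 * h) ^ (n + 1) := by gcongr; omega
      _ = A * 2 ^ (n + 1) * h * h ^ n := by rw [mul_pow, pow_succ h]; ring
      _ ≤ N / 8 * h ^ n := Nat.mul_le_mul_right _ h2
  · calc N ≤ A * B * (h + 1) := hNh.le
      _ ≤ A * B * (2 * h) := Nat.mul_le_mul_left _ (by omega)
      _ = _ := by ring

set_option maxHeartbeats 1000000 in
/-- At large height `N`, at least half of every ball is approximable to the precision `r - κ`, where
`κ` does not depend on the ball. -/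
theorem exists_eventually_half_le {α : Fin m → ℤ_[p]}
    (hα : diophantineExponent α ≤ ((m + 1 : ℝ) : EReal)) (hd : 1 ≤ d) (hm : 1 ≤ m) {τ : Fin m → ℝ}
    (hτ : ∀ i, 1 < τ i) (hτsum : ∑ i, τ i < (m : ℝ) + 1) {v : Fin d → ℝ} (hv : ∀ j, 1 < v j)
    (hvτ : ∑ j, v j + ∑ i, τ i = ((d + m + 1 : ℕ) : ℝ)) :
    ∃ κ : ℕ, ∀ (x₀ : Fin d → ℤ_[p]) (t : ℕ), ∀ᶠ N : ℕ in atTop,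
      ∀ (s : Fin m → ℕ) (r : Fin d → ℕ),
        (∀ i, (N : ℝ) ^ τ i < (p : ℝ) ^ s i ∧ (p : ℝ) ^ s i ≤ p * (N : ℝ) ^ τ i) →
        (∀ j, (N : ℝ) ^ v j < (p : ℝ) ^ r j ∧ (p : ℝ) ^ r j ≤ p * (N : ℝ) ^ v j) →
        (∀ j, t + κ ≤ r j) ∧
        1 / 2 * ((p : ℝ) ^ t)⁻¹ ^ d ≤ (haar p d).real
          {x | x ∈ (Set.univ.pi fun j => Metric.closedBall (x₀ j) ((p : ℝ) ^ (-t : ℤ))) ∧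
            IsApproximable α s (fun j => r j - κ) N x} := by
  have hp := prime_cast_pos (p := p)
  have hpp : p.Prime := Fact.out
  set n := d + m with hn
  obtain ⟨γ, hγ0, hγ1, hcov⟩ := exists_eventually_covers hα hm hτ hτsum
  obtain ⟨δ, hδ0, hδ1, hpart⟩ := exists_eventually_pPart_le hα hm hτ hτsum
  -- `A` controls the measure of the points with a short lattice vector, `B₁` the covering radius
  -- and `B₂` the ratio of `N ^ (n + 1)` to the index; none of them depends on `P`.
  set A : ℕ := 4 * 3 ^ (n + 1) with hA
  set B₁ : ℕ := 8 * (A * 2 ^ (n + 1)) with hB₁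
  set B₂ : ℕ := p ^ d * (p ^ n * B₁ ^ (n + 1)) with hB₂
  clear_value A
  have hApos : 0 < A := by rw [hA]; positivity
  have hB₁pos : 0 < B₁ := by rw [hB₁]; positivity
  have hB₂pos : 0 < B₂ := Nat.mul_pos (pow_pos hpp.pos _)
    (Nat.mul_pos (pow_pos hpp.pos _) (pow_pos hB₁pos _))
  set B₃ : ℝ := 4 * (d + m) * 6 ^ (n + 1) * B₂ with hB₃
  have hB₃pos : 0 < B₃ := by
    rw [hB₃]
    have : (1 : ℝ) ≤ d := by exact_mod_cast hd
    have : (0 : ℝ) < B₂ := by exact_mod_cast hB₂pos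
    positivity
  clear_value B₁ B₂ B₃
  -- The primes up to `y` are put into `P`; the larger ones contribute a share of order `1 / y` to the
  -- exceptional sets, and `4 B₃ ≤ y` makes this small enough.
  obtain ⟨y, hy⟩ := exists_nat_ge (4 * B₃)
  set P : ℕ := y.factorial * p with hP
  have hPpos : 0 < P := Nat.mul_pos (Nat.factorial_pos y) hpp.pos
  have hpP : p ∣ P := dvd_mul_left _ _
  have hyP : ∀ l : ℕ, l.Prime → l ≤ y → l ∣ P := fun l hl hly =>
    (Nat.dvd_factorial hl.pos hly).mul_right _
  clear_value P
  have hP1 : (1 : ℝ) ≤ P := by exact_mod_cast hPpos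
  obtain ⟨κ, hκ1, hκ2⟩ := exists_pow_near_mul (p := p) (C := P * (p ^ n * B₁ ^ (n + 1))) hd
    (Nat.mul_pos hPpos (Nat.mul_pos (pow_pos hpp.pos _) (pow_pos hB₁pos _)))
  refine ⟨κ, fun x₀ t => ?_⟩
  -- Primes above `N ^ ξ` count as large; translates by up to `N ^ ξ` vectors of norm `N ^ γ` stay in
  -- the box since `ξ + γ < 1`.
  set ξ := (1 - γ) / 2 with hξ
  have hξ0 : 0 < ξ := by rw [hξ]; linarith
  have hpt : (0 : ℝ) < (p : ℝ) ^ t := by positivity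
  have ev1 : ∀ᶠ N : ℕ in atTop, ∀ j, (p : ℝ) ^ (t + κ) * (N : ℝ) ^ (1 : ℝ) ≤ (N : ℝ) ^ v j :=
    eventually_all.2 fun j => eventually_mul_rpow_le _ (hv j)
  filter_upwards [hcov P hPpos, hpart, ev1, eventually_ge_atTop 8, eventually_ge_atTop (p ^ t),
    eventually_ge_atTop (2 * (A * B₂)),
    eventually_mul_rpow_le (6 * (A * B₂)) hγ1,
    eventually_mul_rpow_le 1 hγ0,
    eventually_mul_rpow_le (2 * (A * B₂) * (p : ℝ) ^ t) (show 1 - δ < 1 by linarith),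
    eventually_mul_rpow_le 6 (show ξ + γ < 1 by rw [hξ]; linarith),
    eventually_mul_rpow_le 1 hξ0,
    eventually_mul_log_le (32 * B₃) hξ0,
    eventually_mul_log_le (4 * B₃ * (p : ℝ) ^ t) one_pos] with
    N hcovN hpartN h1 hN8 hNt hNAC hNγ hγN hNδ hNξ hξN hlog1 hlog2 s r hs hr
  simp only [Real.rpow_one, Real.rpow_zero, mul_one] at h1 hNγ hγN hNδ hNξ hξN hlog2
  have hN0 : 0 < N := by omega
  have hNpos : (0 : ℝ) < N := by exact_mod_cast hN0
  have hN1 : (1 : ℝ) ≤ N := by exact_mod_cast hN0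
  have hκr : ∀ j, t + κ ≤ r j := by
    intro j
    have h2 : (p : ℝ) ^ (t + κ) < (p : ℝ) ^ r j :=
      lt_of_le_of_lt (le_trans (le_mul_of_one_le_right (by positivity) hN1) (h1 j)) (hr j).1
    exact ((Nat.pow_lt_pow_iff_right hpp.one_lt).1 (by exact_mod_cast h2)).le
  refine ⟨hκr, ?_⟩
  have hsplit : ∀ j, (p : ℝ) ^ r j = (p : ℝ) ^ κ * (p : ℝ) ^ (r j - κ) := fun j => by
    rw [← pow_add]; congr 1; have := hκr j; omega
  have hrN : ∀ j, N ≤ p ^ (r j - κ) := by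
    intro j
    have h2 : (p : ℝ) ^ κ * N ≤ (p : ℝ) ^ κ * (p : ℝ) ^ (r j - κ) := by
      rw [← hsplit j]
      refine le_trans (le_trans ?_ (h1 j)) (hr j).1.le
      gcongr
      · exact_mod_cast hpp.one_lt.le
      · omega
    exact_mod_cast le_of_mul_le_mul_left h2 (by positivity)
  obtain ⟨hWup, hWlow⟩ := index_bounds hN0 hPpos hs hr hvτ
    (fun j => (Nat.le_add_left κ t).trans (hκr j)) hκ1 hκ2
  set W : ℕ := P * (∏ i, p ^ s i) * ∏ j, p ^ (r j - κ) with hW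
  have hWr : (W : ℝ) = P * (∏ i, (p : ℝ) ^ s i) * ∏ j, (p : ℝ) ^ (r j - κ) := by
    rw [hW]; push_cast; rfl
  rw [← hB₂] at hWlow
  rw [hB₁] at hWup
  obtain ⟨h, hhpos, hhN, hh1, hh2, hNh⟩ := exists_scale hApos hB₂pos hWup hWlow hNAC
  have hNh2 : (N : ℝ) ≤ 2 * (A * B₂) * h := by exact_mod_cast hNh
  have hACpos : (0 : ℝ) < A * B₂ := by exact_mod_cast Nat.mul_pos hApos hB₂pos
  set ρ := ⌊(N : ℝ) ^ γ⌋₊ with hρ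
  have hρle : (ρ : ℝ) ≤ (N : ℝ) ^ γ := Nat.floor_le (by positivity)
  have hρ3 : ((2 * ρ + 1 : ℕ) : ℝ) ≤ 3 * (N : ℝ) ^ γ := by push_cast; linarith
  have hρh : 2 * ρ + 1 ≤ h := by
    have h2 : (2 * (A * B₂) : ℝ) * ((2 * ρ + 1 : ℕ) : ℝ) ≤ (2 * (A * B₂)) * h := by
      calc (2 * (A * B₂) : ℝ) * ((2 * ρ + 1 : ℕ) : ℝ) ≤ (2 * (A * B₂)) * (3 * (N : ℝ) ^ γ) := by gcongr
        _ = 6 * (A * B₂) * (N : ℝ) ^ γ := by ring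
        _ ≤ N := hNγ
        _ ≤ _ := hNh2
    exact_mod_cast le_of_mul_le_mul_left h2 (by positivity)
  set X := ⌊(N : ℝ) ^ ξ⌋₊ with hX
  have hXle : (X : ℝ) ≤ (N : ℝ) ^ ξ := Nat.floor_le (by positivity)
  have hX1 : 1 ≤ X := Nat.le_floor (by simpa using hξN)
  have hX1' : (1 : ℝ) ≤ X := by exact_mod_cast hX1
  have hX2 : (N : ℝ) ^ ξ ≤ 2 * X := by
    have := Nat.lt_floor_add_one ((N : ℝ) ^ ξ)
    linarith
  have hKN := four_mul_sq_lt_two_pow N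
  set K := 2 * Nat.log 2 N + 4 with hK
  have hK1 : (1 : ℝ) ≤ K := by exact_mod_cast (by omega : 1 ≤ K)
  clear_value K X ρ
  refine half_le_real_isApproximable (P := P) (h := h) (ρ := ρ) (X := X) (K := K) (y := y)
    hpP hPpos x₀ hyP hN8 hhpos hhN
    (fun i => (lt_pow_of_rpow_lt (hτ i) hN0 (hs i).1).le) hrN hNt hh2 (hcovN s hs) hρh ?_ hX1 ?_
    hKN ?_ ?_
  · intro z hz hz0 hzh e he
    have h2 := hpartN P s (fun i => (hs i).1) z hz hz0
      (fun o => (hzh o).trans (by exact_mod_cast hhN)) e he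
    have h3 : (2 * (A * B₂) : ℝ) * ((p : ℝ) ^ t * (p : ℝ) ^ e) ≤ (2 * (A * B₂)) * h := by
      calc (2 * (A * B₂) : ℝ) * ((p : ℝ) ^ t * (p : ℝ) ^ e)
          ≤ (2 * (A * B₂)) * ((p : ℝ) ^ t * (N : ℝ) ^ (1 - δ)) := by gcongr
        _ = 2 * (A * B₂) * (p : ℝ) ^ t * (N : ℝ) ^ (1 - δ) := by ring
        _ ≤ N := hNδ
        _ ≤ _ := hNh2
    have h4 := le_of_mul_le_mul_left h3 (by positivity)
    rw [← pow_add] at h4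
    exact_mod_cast h4
  · have h2 : ((2 * X * (2 * ρ + 1) : ℕ) : ℝ) ≤ N := by
      calc ((2 * X * (2 * ρ + 1) : ℕ) : ℝ) = 2 * X * ((2 * ρ + 1 : ℕ) : ℝ) := by push_cast; ring
        _ ≤ 2 * (N : ℝ) ^ ξ * (3 * (N : ℝ) ^ γ) := by gcongr
        _ = 6 * (N : ℝ) ^ (ξ + γ) := by rw [Real.rpow_add hNpos]; ring
        _ ≤ N := hNξ
    exact_mod_cast h2
  · rw [← hWr]
    have h2 : ((A * h ^ (n + 1) : ℕ) : ℝ) ≤ W := by exact_mod_cast hh1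
    refine le_trans (le_of_eq ?_) h2
    rw [hA]; push_cast; rw [mul_pow]; ring
  · rw [← hWr]
    have e1 : B₃ * (2 / (y + 1)) ≤ 1 / 2 := by
      rw [← mul_div_assoc, div_le_iff₀ (by positivity)]; linarith
    have e2 : B₃ * ((1 + 2 * K) / X) ≤ 1 / 4 := by
      rw [← mul_div_assoc, div_le_iff₀ (by positivity)]
      have : B₃ * (1 + 2 * K) ≤ B₃ * (3 * K) := by gcongr; linarith
      linarith
    have e3 : B₃ * (K * p ^ t / N) ≤ 1 / 4 := by
      rw [← mul_div_assoc, div_le_iff₀ hNpos]; linarith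
    have e4 : B₃ * (2 / (y + 1) + (1 + 2 * K) / X + K * p ^ t / N) ≤ 1 := by
      rw [mul_add, mul_add]; linarith
    have hB₂pos' : (0 : ℝ) < B₂ := by exact_mod_cast hB₂pos
    refine le_of_mul_le_mul_left ?_ hB₂pos'
    calc (B₂ : ℝ) * (4 * (d + m) * (2 / (y + 1) + (1 + 2 * K) / X + K * p ^ t / N) *
          (6 * N : ℝ) ^ (n + 1))
        = (B₃ * (2 / (y + 1) + (1 + 2 * K) / X + K * p ^ t / N)) * (N : ℝ) ^ (n + 1) := by
          rw [hB₃, mul_pow]; ring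
      _ ≤ 1 * (N : ℝ) ^ (n + 1) := by gcongr
      _ ≤ _ := by rw [one_mul]; exact_mod_cast hWlow

end Assembly

/-! ### Local ubiquity -/

section Conclusion

variable {p : ℕ} [Fact p.Prime] {d m : ℕ}

theorem norm_natCast_eq_one {q : ℕ} (hq : ¬ p ∣ q) : ‖(q : ℚ_[p])‖ = 1 :=
  Padic.norm_natCast_eq_one_iff.2 ((Nat.Prime.coprime_iff_not_dvd Fact.out).2 hq)

/-- Dividing by a unit `q` does not change the distance to a fraction with denominator `q`. -/
theorem norm_sub_div {q : ℕ} (hq : ¬ p ∣ q) (x : ℤ_[p]) (a : ℤ) :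
    ‖(x : ℚ_[p]) - (a : ℚ_[p]) / (q : ℚ_[p])‖ = ‖(q : ℤ_[p]) * x - a‖ := by
  have h1 := norm_natCast_eq_one hq
  have h0 : (q : ℚ_[p]) ≠ 0 := fun h => by simp [h] at h1
  rw [← PadicInt.padic_norm_e_of_padicInt]
  push_cast
  rw [show (q : ℚ_[p]) * x - a = q * ((x : ℚ_[p]) - (a : ℚ_[p]) / q) by field_simp, norm_mul, h1,
    one_mul]

theorem norm_div_le_one {q : ℕ} (hq : ¬ p ∣ q) (a : ℤ) :
    ‖(a : ℚ_[p]) / (q : ℚ_[p])‖ ≤ 1 := by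
  rw [norm_div, norm_natCast_eq_one hq, div_one]
  exact Padic.norm_int_le_one a

/-- A point approximable to the precision `r - κ` lies within `p ^ (κ - r)` of a point all of whose
`p ^ (-r)`-neighbourhood is in a rectangle around the resonant set of some denominator of the
level. -/
theorem exists_centre {α : Fin m → ℤ_[p]} {τ : Fin m → ℝ} (hτ : ∀ i, 1 < τ i) {v : Fin d → ℝ}
    {M k κ : ℕ} (hM : 2 ≤ M) {s : Fin m → ℕ} {r : Fin d → ℕ}
    (hs : ∀ i, ((M ^ (k + 1) : ℕ) : ℝ) ^ τ i < (p : ℝ) ^ s i)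
    (hr : ∀ j, ((M ^ (k + 1) : ℕ) : ℝ) ^ v j < (p : ℝ) ^ r j)
    {x : Fin d → ℤ_[p]} (hx : IsApproximable α s (fun j => r j - κ) (M ^ (k + 1)) x) :
    ∃ c : Fin d → ℤ_[p], (∀ j, ‖x j - c j‖ ≤ (p : ℝ) ^ (-(r j - κ : ℕ) : ℤ)) ∧
      ∀ y : Fin d → ℤ_[p], (∀ j, ‖y j - c j‖ ≤ (p : ℝ) ^ (-(r j : ℕ) : ℤ)) →
        y ∈ ⋃ q ∈ levelSet α τ M k, rectNbhd (resonant p d q) (rho ((M : ℝ) ^ (k + 1))) v := by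
  obtain ⟨q, hNq, hqN, hpq, ha, hb⟩ := hx
  choose a ha1 ha2 ha3 using ha
  have hN0 : 0 < M ^ (k + 1) := by positivity
  have hq0 : 0 < q := by omega
  refine ⟨fun j => ⟨(a j : ℚ_[p]) / (q : ℚ_[p]), norm_div_le_one hpq (a j)⟩, fun j => ?_,
    fun y hy => ?_⟩
  · refine le_trans (le_of_eq ?_) (ha3 j)
    rw [← norm_sub_div hpq, ← PadicInt.padic_norm_e_of_padicInt]
    push_cast
    rfl
  · refine Set.mem_iUnion₂.2 ⟨q, ⟨⟨hq0, fun i => ?_⟩, ?_, hqN⟩, fun j _ => ?_⟩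
    · obtain ⟨b, hb1, hb2, hb3⟩ := hb i
      refine ⟨b, hb1, hb2, ?_⟩
      rw [norm_sub_div hpq]
      refine lt_of_le_of_lt hb3 (lt_of_lt_of_le (zpow_neg_lt_rpow hN0 (hs i)) ?_)
      exact Real.rpow_le_rpow_of_nonpos (by exact_mod_cast hq0) (by exact_mod_cast hqN.le)
        (by have := hτ i; linarith)
    · have h1 : 2 * M ^ k ≤ 2 * q := by
        refine le_trans ?_ hNq
        rw [pow_succ, mul_comm]
        exact Nat.mul_le_mul_left _ hM
      omega
    · refine Set.mem_iUnion₂.2 ⟨⟨(a j : ℚ_[p]) / (q : ℚ_[p]), norm_div_le_one hpq (a j)⟩,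
        ⟨a j, ha1 j, ha2 j, rfl⟩, ?_⟩
      refine lt_of_le_of_lt ((dist_eq_norm (y j) _).trans_le (hy j)) (lt_of_lt_of_eq (zpow_neg_lt_rpow hN0 (hr j)) ?_)
      rw [rho, Real.inv_rpow (by positivity), ← Real.rpow_neg (by positivity)]
      push_cast
      rfl

/-- The uniform lower bound for the measure of the union of the rectangles of one level inside an
arbitrary ball. -/
theorem exists_eventually_le_haar {α : Fin m → ℤ_[p]}
    (hα : diophantineExponent α ≤ ((m + 1 : ℝ) : EReal)) (hd : 1 ≤ d) (hm : 1 ≤ m) {τ : Fin m → ℝ}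
    (hτ : ∀ i, 1 < τ i) (hτsum : ∑ i, τ i < (m : ℝ) + 1) {v : Fin d → ℝ} (hv : ∀ j, 1 < v j)
    (hvτ : ∑ j, v j + ∑ i, τ i = ((d + m + 1 : ℕ) : ℝ)) {M : ℕ} (hM : 2 ≤ M) :
    ∃ c : ℝ, 0 < c ∧ ∀ (x : Fin d → ℤ_[p]) (r : ℝ), 0 < r → ∀ᶠ k : ℕ in atTop,
      ENNReal.ofReal c * haar p d (Metric.ball x r) ≤
        haar p d (Metric.ball x r ∩ ⋃ q ∈ levelSet α τ M k,
          rectNbhd (resonant p d q) (rho ((M : ℝ) ^ (k + 1))) v) := by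
  have hp := prime_cast_pos (p := p)
  obtain ⟨κ, hκ⟩ := exists_eventually_half_le hα hd hm hτ hτsum hv hvτ
  refine ⟨1 / 2 * ((p : ℝ) ^ (κ * d))⁻¹, by positivity, fun x ε hε => ?_⟩
  obtain ⟨t, ht⟩ := exists_ball_eq_pi (p := p) d hε
  have hN : Tendsto (fun k => M ^ (k + 1)) atTop atTop :=
    (tendsto_pow_atTop_atTop_of_one_lt hM).comp (tendsto_add_atTop_nat 1)
  filter_upwards [hN.eventually (hκ x t)] with k hk
  set V := Metric.ball x ε ∩ ⋃ q ∈ levelSet α τ M k,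
    rectNbhd (resonant p d q) (rho ((M : ℝ) ^ (k + 1))) v with hV
  have hN1 : (1 : ℝ) ≤ ((M ^ (k + 1) : ℕ) : ℝ) := by
    exact_mod_cast Nat.one_le_pow _ _ (by omega)
  have hs : ∀ i, ∃ s : ℕ, ((M ^ (k + 1) : ℕ) : ℝ) ^ τ i < (p : ℝ) ^ s ∧
      (p : ℝ) ^ s ≤ p * ((M ^ (k + 1) : ℕ) : ℝ) ^ τ i := fun i =>
    exists_pow_gt_le (Real.one_le_rpow hN1 (zero_le_one.trans (hτ i).le))
  have hr : ∀ j, ∃ s : ℕ, ((M ^ (k + 1) : ℕ) : ℝ) ^ v j < (p : ℝ) ^ s ∧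
      (p : ℝ) ^ s ≤ p * ((M ^ (k + 1) : ℕ) : ℝ) ^ v j := fun j =>
    exists_pow_gt_le (Real.one_le_rpow hN1 (zero_le_one.trans (hv j).le))
  choose s hs using hs
  choose r hr using hr
  obtain ⟨htr, hhalf⟩ := hk s r hs hr
  have hcoarse := haar_real_le_of_coarse (p := p) (d := d) (κ := κ) (r := fun j => r j - κ)
    (U := {y | y ∈ (Set.univ.pi fun j => Metric.closedBall (x j) ((p : ℝ) ^ (-t : ℤ))) ∧
      IsApproximable α s (fun j => r j - κ) (M ^ (k + 1)) y}) (V := V) (by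
    rintro y ⟨hy, hyA⟩
    obtain ⟨c, hc, hcV⟩ := exists_centre hτ hM (fun i => (hs i).1) (fun j => (hr j).1) hyA
    refine ⟨c, hc, fun z hz => ⟨?_, hcV z fun j => ?_⟩⟩
    · rw [ht]
      intro j hj
      have h1 : ∀ e : ℕ, t ≤ e → (p : ℝ) ^ (-(e : ℤ)) ≤ (p : ℝ) ^ (-t : ℤ) := fun e he =>
        zpow_le_zpow_right₀ (by exact_mod_cast (Fact.out : p.Prime).one_lt.le) (by omega)
      have h2 := hy j hj
      rw [Metric.mem_closedBall, dist_eq_norm] at h2 ⊢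
      have h3 : ‖z j - c j‖ ≤ (p : ℝ) ^ (-t : ℤ) := (hz j).trans (h1 _ (by have := htr j; omega))
      have h4 : ‖y j - c j‖ ≤ (p : ℝ) ^ (-t : ℤ) := (hc j).trans (h1 _ (by have := htr j; omega))
      rw [show z j - x j = (z j - c j) - (y j - c j) + (y j - x j) by ring]
      exact (PadicInt.nonarchimedean _ _).trans (max_le
        ((norm_sub_le_max_padicInt _ _).trans (max_le h3 h4)) h2)
    · have := hz j
      rwa [show r j - κ + κ = r j by have := htr j; omega] at this)
  have hball : (haar p d).real (Metric.ball x ε) = ((p : ℝ) ^ t)⁻¹ ^ d := by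
    rw [ht, haar_real_pi, Finset.prod_congr rfl fun j _ => haar1_real_closedBall (x j) t]
    simp
  have hfin := haar_univ p d
  have : IsFiniteMeasure (haar p d) := ⟨by rw [hfin]; exact ENNReal.one_lt_top⟩
  have hreal : 1 / 2 * ((p : ℝ) ^ (κ * d))⁻¹ * (haar p d).real (Metric.ball x ε) ≤
      (haar p d).real V := by
    rw [hball, mul_right_comm, ← div_eq_mul_inv, div_le_iff₀ (by positivity),
      mul_comm _ ((p : ℝ) ^ _)]
    exact hhalf.trans hcoarse
  rw [← ofReal_measureReal, ← ofReal_measureReal, ← ENNReal.ofReal_mul (by positivity)]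
  exact ENNReal.ofReal_le_ofReal hreal

theorem two_le_of_C₁_lt {M : ℕ} (hm : 1 ≤ m) {θ : ℝ} (hθ : 0 ≤ θ)
    (hM : (3 ^ d * C₁ m) ^ θ < (M : ℝ)) : 2 ≤ M := by
  have h1 : (1 : ℝ) ≤ √(m : ℝ) := Real.one_le_sqrt.2 (by exact_mod_cast hm)
  have h2 : (1 : ℝ) ≤ C₁ m := by
    refine le_trans ?_ (le_max_left _ _)
    have : (1 : ℝ) ≤ (6 * √(m : ℝ)) ^ m := one_le_pow₀ (by linarith)
    linarith
  have h3 : (1 : ℝ) ≤ 3 ^ d := one_le_pow₀ (by norm_num)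
  have h4 : (1 : ℝ) < M :=
    lt_of_le_of_lt (Real.one_le_rpow (one_le_mul_of_one_le_of_one_le h3 h2) hθ) hM
  exact_mod_cast h4

/-- A uniform lower bound for the levels makes the system of rectangles locally ubiquitous. -/
theorem isLocallyUbiquitous_of_le {α : Fin m → ℤ_[p]} {τ : Fin m → ℝ} {v : Fin d → ℝ}
    (hv : ∀ j, 1 < v j) {M : ℕ} (hM : 2 ≤ M) {c : ℝ} (hc : 0 < c)
    (h : ∀ (x : Fin d → ℤ_[p]) (r : ℝ), 0 < r → ∀ᶠ k : ℕ in atTop,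
      ENNReal.ofReal c * haar p d (Metric.ball x r) ≤
        haar p d (Metric.ball x r ∩ ⋃ q ∈ levelSet α τ M k,
          rectNbhd (resonant p d q) (rho ((M : ℝ) ^ (k + 1))) v)) :
    IsLocallyUbiquitous (ι := denominators α τ) (X := fun _ : Fin d => ℤ_[p])
      (fun _ => haar1 p) (fun q => resonant p d (q : ℕ)) (fun q => ((q : ℕ) : ℝ)) rho v
      (fun k => (M : ℝ) ^ k) (fun k => (M : ℝ) ^ (k + 1)) where
  countable := inferInstance
  infinite := by
    rw [Set.infinite_coe_iff]
    refine Set.infinite_of_not_bddAbove ?_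
    rintro ⟨B, hB⟩
    have hpos : 0 < haar p d (Metric.ball 0 1) := by
      have := haar_isAddHaarMeasure p d
      exact Metric.measure_ball_pos _ _ one_pos
    obtain ⟨k, hk, hBk⟩ := ((h 0 1 one_pos).and (eventually_ge_atTop (B + 1))).exists
    have hne : 0 < haar p d (Metric.ball 0 1 ∩ ⋃ q ∈ levelSet α τ M k,
        rectNbhd (resonant p d q) (rho ((M : ℝ) ^ (k + 1))) v) :=
      lt_of_lt_of_le (ENNReal.mul_pos (ENNReal.ofReal_pos.2 hc).ne' hpos.ne') hk
    obtain ⟨y, -, hy⟩ := nonempty_of_measure_ne_zero hne.ne'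
    obtain ⟨q, ⟨hq, hMq, -⟩, -⟩ := Set.mem_iUnion₂.1 hy
    have h1 := hB hq
    have h2 : k < M ^ k := Nat.lt_pow_self hM
    omega
  beta_pos q := by exact_mod_cast q.2.1
  exponent_pos j := zero_lt_one.trans (hv j)
  l_pos k := by
    have : 0 < M := by omega
    positivity
  l_le_u k := pow_le_pow_right₀ (by exact_mod_cast (by omega : 1 ≤ M)) (Nat.le_succ k)
  l_tendsto := tendsto_pow_atTop_atTop_of_one_lt (by exact_mod_cast hM)
  rho_pos t ht := inv_pos.2 ht
  rho_antitone a ha b _ hab := inv_anti₀ ha hab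
  rho_tendsto := tendsto_inv_atTop_zero.comp tendsto_comap
  ubiquity := by
    refine ⟨c, hc, fun x r hr => le_limsup_of_frequently_le (Eventually.frequently ?_)⟩
    filter_upwards [h x r hr] with k hk
    refine hk.trans (measure_mono (Set.inter_subset_inter_right _ ?_))
    refine Set.iUnion₂_subset fun q hq => ?_
    exact Set.subset_iUnion₂_of_subset (⟨q, hq.1⟩ : denominators α τ)
      ⟨by exact_mod_cast hq.2.1, by exact_mod_cast hq.2.2.le⟩ subset_rfl

end Conclusion

end PadicUbiquity

theorem mainTheorem6 (p : ℕ) [Fact p.Prime] (d m : ℕ) (hd : 1 ≤ d) (hm : 1 ≤ m)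
    (α : Fin m → ℤ_[p])
    (hα : PadicUbiquity.diophantineExponent α = ((m + 1 : ℝ) : EReal))
    (τ : Fin m → ℝ) (hτ : ∀ i, 1 < τ i) (hτsum : ∑ i, τ i < (m : ℝ) + 1)
    (v : Fin d → ℝ) (hv : ∀ i, 1 < v i)
    (hvsum : ∑ i, v i = ((d + m : ℕ) : ℝ) + 1 - ∑ i, τ i)
    (M : ℕ)
    (hM : (3 ^ d * PadicUbiquity.C₁ m) ^ (1 / (((d + m : ℕ) : ℝ) + 1 - ∑ i, τ i)) < (M : ℝ)) :
    (∃ c : ℝ, 0 < c ∧ ∃ r₀ : ℝ, 0 < r₀ ∧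
      ∀ (x : Fin d → ℤ_[p]) (r : ℝ), 0 < r → r < r₀ →
        ∃ k₀ : ℕ, ∀ k : ℕ, k₀ ≤ k →
          ENNReal.ofReal c * PadicUbiquity.haar p d (Metric.ball x r) ≤
            PadicUbiquity.haar p d (Metric.ball x r ∩
              ⋃ q ∈ PadicUbiquity.levelSet α τ M k,
                PadicUbiquity.rectNbhd (PadicUbiquity.resonant p d q)
                  (PadicUbiquity.rho ((M : ℝ) ^ (k + 1))) v)) ∧
    PadicUbiquity.IsLocallyUbiquitous
      (ι := PadicUbiquity.denominators α τ) (X := fun _ : Fin d => ℤ_[p])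
      (fun _ => PadicUbiquity.haar1 p)
      (fun q => PadicUbiquity.resonant p d (q : ℕ))
      (fun q => ((q : ℕ) : ℝ)) PadicUbiquity.rho v
      (fun k => (M : ℝ) ^ k) (fun k => (M : ℝ) ^ (k + 1)) := by
  have hvτ : ∑ j, v j + ∑ i, τ i = ((d + m + 1 : ℕ) : ℝ) := by
    rw [hvsum]; push_cast; ring
  have hM2 : 2 ≤ M := by
    refine PadicUbiquity.two_le_of_C₁_lt hm ?_ hM
    have : (0 : ℝ) ≤ d := Nat.cast_nonneg d
    refine div_nonneg zero_le_one ?_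
    push_cast
    linarith
  obtain ⟨c, hc, h⟩ := PadicUbiquity.exists_eventually_le_haar hα.le hd hm hτ hτsum hv hvτ hM2
  exact ⟨⟨c, hc, 1, one_pos, fun x r hr _ => eventually_atTop.1 (h x r hr)⟩,
    PadicUbiquity.isLocallyUbiquitous_of_le hv hM2 hc h⟩
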